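/- Let $\Gamma\subset\mathbb R^2$ be a finite metric graph embedded in the plane: it has finitely many vertices, no isolated vertices, and finitely many edges $e_j$, $j\in J$, which are straight, have lengths $l_{e_j}\in(0,+\infty]$, and meet only at vertices; an edge of finite length joins two vertices, an edge of infinite length is a half-line issuing from a vertex. For each edge fix Cartesian coordinates $(x_j,y_j)$ of $\mathbb R^2$, where $x_j$ is the arc length along $e_j$ measured from one of its vertices (so that $e_j=\{y_j=0,\ 0\le x_j\le l_{e_j}\}$, with $x_j<\infty$) and $y_j$ is the orthogonal coordinate. For $\varepsilon>0$ let $$\widehat H(\varepsilon)=-\tfrac12\Delta+\tfrac1{2\varepsilon^2}d_\Gamma^2,\qquad d_\Gamma(q)=\inf_{\tilde q\in\Gamma}|q-\tilde q|,$$ be the self-adjoint operator on $L^2(\mathbb R^2)$ associated with the closed quadratic form $\tfrac12\|\nabla\psi\|^2+\tfrac1{2\varepsilon^2}\|d_\Gamma\psi\|^2$ on $\{\psi\in H^1(\mathbb R^2): d_\Gamma\psi\in L^2(\mathbb R^2)\}$. For $k\in\mathbb N_0$ let $\Phi_k^\varepsilon$ be the $L^2(\mathbb R)$-normalized $k$-th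 eigenfunction (Hermite function) of the harmonic oscillator, $\big(-\tfrac12\tfrac{d^2}{dy^2}+\tfrac{y^2}{2\varepsilon^2}\big)\Phi_k^\varepsilon=\tfrac{E_k}{\varepsilon}\Phi_k^\varepsilon$, $E_k=k+\tfrac12$. Fix $n\in\mathbb N_0$, an edge $e_{j_0}$ and $f\in C_0^\infty((0,l_{e_{j_0}}))$, all independent of $\varepsilon$. Let $\psi_0^\varepsilon=f(x_{j_0})\,\Phi_n^\varepsilon(y_{j_0})$, $$\psi_t^\varepsilon=\exp\!\Big(-it\big(\widehat H(\varepsilon)-\tfrac{E_n}{\varepsilon}\big)\Big)\psi_0^\varepsilon,\qquad s_j^m(t,x_j;\varepsilon)=\int_{\mathbb R}\Phi_m^\varepsilon(y_j)^*\,\psi_t^\varepsilon(x_j,y_j)\,dy_j .$$ Then for every $T>0$, every $m\in\mathbb N_0$ with $m\neq n$ and every edge $e_j$, the functions $s_j^m(\cdot,\cdot;\varepsilon)$ belong to $L^\infty((0,T),L^2(\mathbb R))$ and $$s_j^m(t,x_j;\varepsilon)\overset{*}{\rightharpoonup}0\qquad(\varepsilon\to0)$$ in the weak$^*$ topology of $L^\infty((0,T),L^2(\mathbb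 R))$, i.e. $\int_0^T\langle g(t),s_j^m(t,\cdot;\varepsilon)\rangle_{L^2(\mathbb R)}\,dt\to0$ for every $g\in L^1((0,T),L^2(\mathbb R))$. -/

import Mathlib

open Complex Filter Topology MeasureTheory Set
open scoped ContDiff Distributions ENNReal

/-! ### The plane, the line and their Hilbert spaces -/

/-- The Euclidean plane. -/
abbrev Plane : Type := EuclideanSpace ℝ (Fin 2)

/-- The Hilbert space of complex square integrable functions on the plane. -/
abbrev L2Plane : Type := Lp ℂ 2 (volume : Measure Plane)

/-- The Hilbert space of complex square integrable functions on the line. -/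
abbrev L2Line : Type := Lp ℂ 2 (volume : Measure ℝ)

/-! ### Finite metric graphs with straight edges in the plane -/

/-- The open interval of parameters strictly between `0` and `l`, where `l` may be infinite. -/
def edgeInterval (l : ℝ≥0∞) : TopologicalSpace.Opens ℝ :=
  ⟨{x | 0 < x ∧ ENNReal.ofReal x < l},
    (isOpen_lt continuous_const continuous_id).inter
      (isOpen_lt ENNReal.continuous_ofReal continuous_const)⟩

/-- The open straight edge of length `l` starting at `p` in the direction of the unit vector `d`. -/
def openEdge (p d : Plane) (l : ℝ≥0∞) : Set Plane :=
  (fun x : ℝ => p + x • d) '' {x | 0 < x ∧ ENNReal.ofReal x < l}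

/-- The edge together with its end points (a half-line with its origin if `l = ⊤`). -/
def closedEdge (p d : Plane) (l : ℝ≥0∞) : Set Plane :=
  (fun x : ℝ => p + x • d) '' {x | 0 ≤ x ∧ ENNReal.ofReal x ≤ l}

/-- A metric graph with vertex set `V` and edge set `E`, embedded in the plane with straight edges
of positive, possibly infinite, length and without isolated vertices. An edge of infinite length is
a half-line issuing from a vertex; an edge of finite length joins two vertices. Each edge carries
the orientation given by its natural coordinate `x`, the arc length measured from `source e`. -/
structure StraightGraph (V E : Type*) where
  /-- The position of a vertex. -/
  pos : V → Plane
  pos_injective : Function.Injective pos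
  /-- The vertex of an edge at which the natural coordinate is zero. -/
  source : E → V
  /-- The unit tangent vector of an edge. -/
  dir : E → Plane
  norm_dir : ∀ e, ‖dir e‖ = 1
  /-- The length of an edge. -/
  length : E → ℝ≥0∞
  length_pos : ∀ e, 0 < length e
  exists_target : ∀ e, length e ≠ ⊤ →
    ∃ v, pos v = pos (source e) + (length e).toReal • dir e
  pos_notMem_openEdge : ∀ v e, pos v ∉ openEdge (pos (source e)) (dir e) (length e)
  disjoint_openEdge : ∀ e e', e ≠ e' → Disjoint (openEdge (pos (source e)) (dir e) (length e))
    (openEdge (pos (source e')) (dir e') (length e'))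
  not_isolated : ∀ v, ∃ e, pos v ∈ closedEdge (pos (source e)) (dir e) (length e)

/-- The graph as a subset of the plane (it contains the vertices, as none of them is isolated). -/
def StraightGraph.carrier {V E : Type*} (Γ : StraightGraph V E) : Set Plane :=
  ⋃ e, closedEdge (Γ.pos (Γ.source e)) (Γ.dir e) (Γ.length e)

/-! ### The Hamiltonian `H(ε) = -(1/2) Δ + (1/(2 ε²)) d²`, with `d` the distance from a set

It is the self-adjoint operator associated with the closed quadratic form
`(1/2) ‖∇ψ‖² + (1/(2 ε²)) ‖d ψ‖²` on the form domain of all `ψ` in `H¹` with `d ψ` in `L²`. -/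

/-- `η` is the weak partial derivative of `ψ` in the direction of the `i`-th coordinate. -/
def HasWeakPartial (i : Fin 2) (ψ η : L2Plane) : Prop :=
  ∀ χ : Plane → ℂ, ContDiff ℝ ∞ χ → HasCompactSupport χ →
    ∫ q, ψ q * fderiv ℝ χ q (EuclideanSpace.single i 1) = -∫ q, η q * χ q

/-- `ψ` belongs to the form domain, with weak gradient `D` and with `w = d ψ`, where `d` is the
distance from the set `Γ`. -/
structure IsFormElement (Γ : Set Plane) (ψ : L2Plane) (D : Fin 2 → L2Plane) (w : L2Plane) :
    Prop where
  weak : ∀ i, HasWeakPartial i ψ (D i)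
  dist : ∀ᵐ q, w q = (Metric.infDist q Γ : ℂ) * ψ q

/-- The graph of the Hamiltonian: `ψ` belongs to the domain of `H(ε)` and `H(ε) ψ = η`. -/
def IsHamiltonian (Γ : Set Plane) (ε : ℝ) (ψ η : L2Plane) : Prop :=
  ∃ D w, IsFormElement Γ ψ D w ∧ ∀ χ D' w', IsFormElement Γ χ D' w' →
    (1 / 2) * ∑ i, inner ℂ (D' i) (D i) + 1 / (2 * ε ^ 2) * inner ℂ w' w = inner ℂ χ η

/-! ### The unitary group generated by a self-adjoint operator -/

/-- `U` is a strongly continuous one-parameter unitary group whose infinitesimal generator is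
`-i H`, that is `U t = exp (-i t H)`. The operator `H` is given by its graph: `H ψ η` means that `ψ`
is in the domain and `η` is the value. (Each `U t` is isometric and, by the group law,
invertible.) -/
structure IsUnitaryGroup {E : Type*} [NormedAddCommGroup E] [InnerProductSpace ℂ E]
    (H : E → E → Prop) (U : ℝ → E →L[ℂ] E) : Prop where
  zero : U 0 = 1
  add : ∀ s t, U (s + t) = U s * U t
  norm_map : ∀ t ψ, ‖U t ψ‖ = ‖ψ‖
  continuous : ∀ ψ, Continuous fun t => U t ψ
  generator : ∀ ψ η, H ψ η ↔ HasDerivAt (fun t => U t ψ) (-I • η) 0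

/-- The group `t ↦ exp (-i t H)`. It exists for the Hamiltonian above, see
`isUnitaryGroup_hamiltonian`, and a unitary group is determined by its generator. -/
noncomputable def unitaryGroup {E : Type*} [NormedAddCommGroup E] [InnerProductSpace ℂ E]
    (H : E → E → Prop) : ℝ → E →L[ℂ] E :=
  Classical.epsilon (IsUnitaryGroup H)

/-! #### Existence of the group generated by the Hamiltonian -/

noncomputable def gfun (t : ℝ) (z : ℂ) : ℂ := (z.re : ℂ) * exp (I * (-(t * (z.re⁻¹ - 1)) : ℝ))

lemma gfun_cont (t : ℝ) : Continuous (gfun t) := by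
  have h : Continuous fun r : ℝ => (r : ℂ) * exp (I * (-(t * (r⁻¹ - 1)) : ℝ)) := by
    rw [continuous_iff_continuousAt]
    intro r
    by_cases hr : r = 0
    · subst hr
      have : Tendsto (fun r : ℝ => (r : ℂ) * exp (I * (-(t * (r⁻¹ - 1)) : ℝ))) (𝓝 0) (𝓝 0) := by
        rw [tendsto_zero_iff_norm_tendsto_zero]
        have : (fun r : ℝ => ‖(r : ℂ) * exp (I * (-(t * (r⁻¹ - 1)) : ℝ))‖) = fun r => |r| := by
          funext r
          rw [norm_mul, mul_comm I, norm_exp_ofReal_mul_I]; simp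
        rw [this]
        simpa using (continuous_abs.tendsto (0 : ℝ))
      simpa [ContinuousAt] using this
    · have : ContinuousAt (fun r : ℝ => r⁻¹) r := continuousAt_inv₀ hr
      fun_prop
  exact h.comp continuous_re

lemma gfun_zero (z : ℂ) : gfun 0 z = (z.re : ℂ) := by simp [gfun]

lemma gfun_mul (s t : ℝ) (z : ℂ) : gfun s z * gfun t z = (z.re : ℂ) * gfun (s + t) z := by
  simp only [gfun]
  rw [mul_mul_mul_comm, ← Complex.exp_add, mul_assoc]
  congr 3
  push_cast; ring_nf

lemma gfun_conj_mul (t : ℝ) (z : ℂ) : star (gfun t z) * gfun t z = (z.re : ℂ) * z.re := by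
  have : ‖gfun t z‖ = |z.re| := by
    rw [gfun, norm_mul, mul_comm I, norm_exp_ofReal_mul_I]; simp
  rw [show star (gfun t z) = (starRingEnd ℂ) (gfun t z) from rfl, ← normSq_eq_conj_mul_self,
    normSq_eq_norm_sq, this, sq_abs]
  push_cast; ring

lemma gfun_lip (t : ℝ) (z : ℂ) (hz : |z.re| ≤ 1) :
    ‖gfun t z - z.re + I * t * (1 - z.re)‖ ≤ 4 * |t| ∧ ‖gfun t z - z.re‖ ≤ 2 * |t| ∧
    ‖(gfun t z - z.re + I * t * (1 - z.re)) * z.re‖ ≤ 8 * t ^ 2 := by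
  set r := z.re with hr
  have h1r : |1 - r| ≤ 2 := by
    rw [abs_le] at *; constructor <;> linarith [hz.1, hz.2]
  by_cases h0 : r = 0
  · simp only [gfun, ← hr, h0]
    refine ⟨?_, ?_, ?_⟩ <;> simp <;> nlinarith [abs_nonneg t, sq_nonneg t]
  have e1 : r * (t * (r⁻¹ - 1)) = t * (1 - r) := by field_simp
  have a2 : ‖gfun t z - r‖ ≤ 2 * |t| := by
    have : gfun t z - r = r * (exp (I * (-(t * (r⁻¹ - 1)) : ℝ)) - 1) := by
      simp only [gfun, ← hr]; ring
    rw [this, norm_mul]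
    calc _ ≤ ‖(r : ℂ)‖ * ‖(-(t * (r⁻¹ - 1)) : ℝ)‖ := by
          gcongr; exact Real.norm_exp_I_mul_ofReal_sub_one_le
      _ = |t * (1 - r)| := by
          rw [← e1, abs_mul, norm_real, Real.norm_eq_abs, Real.norm_eq_abs, abs_neg]
      _ ≤ _ := by rw [abs_mul, mul_comm]; gcongr
  have a3 : ‖I * t * (1 - r : ℂ)‖ ≤ 2 * |t| := by
    rw [norm_mul, norm_mul, ← ofReal_one, ← ofReal_sub]; simp only [norm_I, norm_real, Real.norm_eq_abs]
    nlinarith [abs_nonneg t]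
  refine ⟨(norm_add_le _ _).trans (by linarith), a2, ?_⟩
  set x := -(t * (r⁻¹ - 1)) with hx
  have key : (gfun t z - r + I * t * (1 - r)) * r = (r : ℂ) ^ 2 * (exp (I * x) - 1 - I * x) := by
    have e2 : (r : ℂ) * x = - (t * (1 - r)) := by
      rw [← ofReal_mul, hx, mul_neg, e1]; push_cast; ring
    simp only [gfun, ← hr, ← hx]
    linear_combination (I * r) * e2
  rw [key, norm_mul, norm_pow, norm_real, Real.norm_eq_abs, sq_abs]
  have b : ‖exp (I * x) - 1 - I * x‖ ≤ 2 * x ^ 2 := by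
    have hIx : ‖I * (x : ℂ)‖ = |x| := by simp
    by_cases h1 : |x| ≤ 1
    · have := norm_exp_sub_one_sub_id_le (x := I * x) (by rw [hIx]; exact h1)
      rw [hIx, sq_abs] at this
      nlinarith [sq_nonneg x]
    · have h2 := Real.norm_exp_I_mul_ofReal_sub_one_le (x := x)
      have h3 := norm_sub_le (exp (I * x) - 1) (I * x)
      rw [hIx] at h3
      rw [Real.norm_eq_abs] at h2
      push Not at h1
      nlinarith [sq_abs x]
  calc _ ≤ r ^ 2 * (2 * x ^ 2) := by gcongr
    _ = 2 * (t * (1 - r)) ^ 2 := by rw [← e1, hx]; ring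
    _ = 2 * t ^ 2 * |1 - r| ^ 2 := by rw [sq_abs]; ring
    _ ≤ 2 * t ^ 2 * 2 ^ 2 := by gcongr
    _ = _ := by ring

theorem exists_unitaryGroup {E : Type*} [NormedAddCommGroup E] [InnerProductSpace ℂ E]
    [CompleteSpace E] (R : E →L[ℂ] E) (hsa : IsSelfAdjoint R) (hn : ‖R‖ ≤ 1)
    (hinj : ∀ x, R x = 0 → x = 0) :
    ∃ U, IsUnitaryGroup (fun ψ φ => ψ = R (ψ + φ)) U := by
  have hnorm : IsStarNormal R := hsa.isStarNormal
  have hre : ∀ z ∈ spectrum ℂ R, (z.re : ℂ) = z := fun z hz => (hsa.mem_spectrum_eq_re hz).symm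
  have habs : ∀ z ∈ spectrum ℂ R, |z.re| ≤ 1 := fun z hz => by
    rcases subsingleton_or_nontrivial E with hE | hE
    · exfalso
      have : Subsingleton (E →L[ℂ] E) := ⟨fun a b => by ext x; exact Subsingleton.elim _ _⟩
      simp [spectrum.of_subsingleton] at hz
    · exact (abs_re_le_norm z).trans ((spectrum.norm_le_norm_of_mem hz).trans hn)
  have hc : ∀ t, ContinuousOn (gfun t) (spectrum ℂ R) := fun t => (gfun_cont t).continuousOn
  set A : ℝ → E →L[ℂ] E := fun t => cfc (gfun t) R with hA
  have hsymm : ∀ x y, inner ℂ (R x) y = inner ℂ x (R y) := fun x y => by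
    rw [← ContinuousLinearMap.adjoint_inner_left, hsa.adjoint_eq]
  have hcre : cfc (fun z : ℂ => (z.re : ℂ)) R = R := by
    rw [cfc_congr (g := fun z => z) (fun z hz => hre z hz)]; exact cfc_id' ℂ R
  have hA0 : A 0 = R := by
    rw [← hcre]; simp only [hA]
    refine cfc_congr fun z _ => gfun_zero z
  have hcr : ContinuousOn (fun z : ℂ => (z.re : ℂ)) (spectrum ℂ R) := by fun_prop
  have hAA : ∀ s t, A s * A t = R * A (s + t) := fun s t => by
    calc A s * A t = cfc (fun z => gfun s z * gfun t z) R := (cfc_mul _ _ _ (hc s) (hc t)).symm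
      _ = cfc (fun z => (z.re : ℂ) * gfun (s + t) z) R := by simp only [gfun_mul]
      _ = cfc (fun z : ℂ => (z.re : ℂ)) R * A (s + t) := cfc_mul _ _ _ hcr (hc _)
      _ = R * A (s + t) := by rw [hcre]
  have hAs : ∀ t, star (A t) * A t = R * R := fun t => by
    calc star (A t) * A t = cfc (fun z => star (gfun t z)) R * A t := by rw [cfc_star]
      _ = cfc (fun z => star (gfun t z) * gfun t z) R :=
          (cfc_mul _ _ _ (continuous_star.comp_continuousOn (hc t)) (hc t)).symm
      _ = cfc (fun z : ℂ => (z.re : ℂ) * z.re) R := by simp only [gfun_conj_mul]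
      _ = R * R := by rw [cfc_mul _ _ _ hcr hcr, hcre]
  have hRA : ∀ t, R * A t = A t * R := fun t => by
    have h1 := hAA 0 t
    have h2 := hAA t 0
    rw [zero_add, hA0] at h1
    rw [add_zero, hA0] at h2
    rw [h2]
  have hAn : ∀ t x, ‖A t x‖ = ‖R x‖ := fun t x => by
    have h1 : inner ℂ (A t x) (A t x) = inner ℂ (R x) (R x) := by
      rw [← ContinuousLinearMap.adjoint_inner_right, hsymm]
      exact congrArg (fun B : E →L[ℂ] E => inner ℂ x (B x)) (hAs t)
    rw [inner_self_eq_norm_sq_to_K, inner_self_eq_norm_sq_to_K] at h1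
    have h2 : ‖A t x‖ ^ 2 = ‖R x‖ ^ 2 := by exact_mod_cast h1
    exact (sq_eq_sq₀ (norm_nonneg _) (norm_nonneg _)).1 h2
  have hcfc : ∀ t : ℝ, A t - R + (I * t) • (1 - R)
      = cfc (fun z => gfun t z - z.re + I * t * (1 - z.re)) R := fun t => by
    have h1 : (1 : E →L[ℂ] E) - R = cfc (fun z : ℂ => 1 - (z.re : ℂ)) R := by
      rw [cfc_sub (fun _ => 1) (fun z : ℂ => (z.re : ℂ)) R (by fun_prop) hcr, hcre]
      congr 1; exact (cfc_const_one ℂ R).symm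
    have h2 : A t - R = cfc (fun z : ℂ => gfun t z - (z.re : ℂ)) R := by
      rw [cfc_sub _ _ R (hc t) hcr, hcre]
    rw [h1, h2, ← cfc_smul (I * t : ℂ) (fun z : ℂ => 1 - (z.re : ℂ)) R (by fun_prop)]
    exact (cfc_add R (fun z => gfun t z - z.re) (fun z => (I * t : ℂ) • (1 - (z.re : ℂ)))
      ((hc t).sub hcr) (by fun_prop)).symm
  have hB1 : ∀ t : ℝ, ‖A t - R + (I * t) • (1 - R)‖ ≤ 4 * |t| := fun t => by
    rw [hcfc]
    exact norm_cfc_le (by positivity) fun z hz => (gfun_lip t z (habs z hz)).1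
  have hB2 : ∀ t : ℝ, ‖A t - R‖ ≤ 2 * |t| := fun t => by
    have h2 : A t - R = cfc (fun z : ℂ => gfun t z - (z.re : ℂ)) R := by
      rw [cfc_sub _ _ R (hc t) hcr, hcre]
    rw [h2]
    exact norm_cfc_le (by positivity) fun z hz => (gfun_lip t z (habs z hz)).2.1
  have hB3 : ∀ t : ℝ, ‖(A t - R + (I * t) • (1 - R)) * R‖ ≤ 8 * t ^ 2 := fun t => by
    have : (A t - R + (I * t) • (1 - R)) * R
        = cfc (fun z => (gfun t z - z.re + I * t * (1 - z.re)) * z.re) R := by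
      rw [hcfc]
      refine (congrArg (fun B => cfc (fun z => gfun t z - z.re + I * t * (1 - z.re)) R * B)
        hcre.symm).trans ?_
      exact (cfc_mul (fun z => gfun t z - z.re + I * t * (1 - z.re)) _ R
        (((hc t).sub hcr).add (by fun_prop)) hcr).symm
    rw [this]
    exact norm_cfc_le (by positivity) fun z hz => (gfun_lip t z (habs z hz)).2.2
  have hdense : DenseRange R := by
    have h1 : (LinearMap.range R.toLinearMap)ᗮ = ⊥ := by
      rw [Submodule.eq_bot_iff]
      intro x hx
      refine hinj x (inner_self_eq_zero (𝕜 := ℂ).1 ?_)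
      rw [hsymm]
      have := (Submodule.mem_orthogonal' _ _).1 hx (R (R x)) ⟨_, rfl⟩
      exact this
    have h2 := Submodule.dense_iff_topologicalClosure_eq_top.2
      ((Submodule.topologicalClosure_eq_top_iff).2 h1)
    exact h2
  set U : ℝ → E →L[ℂ] E := fun t => (A t).toLinearMap.extendOfNorm R.toLinearMap with hU
  have hUR : ∀ t x, U t (R x) = A t x := fun t x =>
    LinearMap.extendOfNorm_eq (f := (A t).toLinearMap) (e := R.toLinearMap) hdense
      ⟨1, fun x => by simp [hAn]⟩ x
  have hext : ∀ S T : E →L[ℂ] E, (∀ x, S (R x) = T (R x)) → S = T := fun S T h => by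
    have := hdense.equalizer S.continuous T.continuous (funext h)
    exact DFunLike.coe_injective this
  have hzero : U 0 = 1 := hext _ _ fun x => by rw [hUR, hA0]; rfl
  have hUcomm : ∀ t, U t * R = R * U t := fun t => hext _ _ fun x => by
    change U t (R (R x)) = R (U t (R x))
    rw [hUR, hUR]
    exact congrArg (fun B : E →L[ℂ] E => B x) (hRA t).symm
  have hadd : ∀ s t, U (s + t) = U s * U t := fun s t => hext _ _ fun x => by
    apply sub_eq_zero.1; apply hinj; rw [map_sub, sub_eq_zero]
    change R (U (s + t) (R x)) = R (U s (U t (R x)))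
    rw [hUR, hUR]
    have h1 : R (U s (A t x)) = U s (R (A t x)) :=
      congrArg (fun B : E →L[ℂ] E => B (A t x)) (hUcomm s).symm
    rw [h1, hUR]
    exact congrArg (fun B : E →L[ℂ] E => B x) (hAA s t).symm
  have hnm : ∀ t ψ, ‖U t ψ‖ = ‖ψ‖ := fun t ψ => by
    have := DenseRange.equalizer hdense (g := fun ψ => ‖U t ψ‖) (h := fun ψ => ‖ψ‖)
      (by fun_prop) (by fun_prop) (funext fun x => by simp [hUR, hAn])
    exact congrFun this ψ
  have hneg : ∀ t x y, inner ℂ x (U t y) = inner ℂ (U (-t) x) y := fun t x y => by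
    have h1 : U t (U (-t) x) = x := by
      change (U t * U (-t)) x = x
      rw [← hadd, add_neg_cancel, hzero]; rfl
    let L : E →ₗᵢ[ℂ] E := ⟨(U t).toLinearMap, hnm t⟩
    conv_lhs => rw [← h1]
    exact L.inner_map_map _ _
  have hcont0 : ∀ ψ, Tendsto (fun t => U t ψ) (𝓝 0) (𝓝 ψ) := fun ψ => by
    rw [Metric.tendsto_nhds_nhds]
    intro δ hδ
    obtain ⟨x, hx⟩ := hdense.exists_dist_lt ψ (show 0 < δ / 3 by positivity)
    refine ⟨δ / (6 * (‖x‖ + 1)), by positivity, fun {t} ht => ?_⟩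
    rw [dist_zero_right, Real.norm_eq_abs] at ht
    have h1 : dist (U t ψ) (U t (R x)) < δ / 3 := by
      rw [dist_eq_norm, ← map_sub, hnm, ← dist_eq_norm]; exact hx
    have h2 : dist (U t (R x)) (R x) ≤ δ / 3 := by
      rw [hUR, dist_eq_norm]
      have h3 : ‖(A t - R) x‖ ≤ 2 * |t| * ‖x‖ := (A t - R).le_of_opNorm_le (hB2 t) x
      refine h3.trans ?_
      have h4 : |t| * (6 * (‖x‖ + 1)) < δ := by
        rwa [lt_div_iff₀ (by positivity)] at ht
      nlinarith [abs_nonneg t, norm_nonneg x]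
    rw [dist_comm] at hx
    calc _ ≤ _ := dist_triangle4 _ (U t (R x)) (R x) _
      _ < δ := by linarith
  have hcont : ∀ ψ, Continuous fun t => U t ψ := fun ψ => by
    rw [continuous_iff_continuousAt]
    intro t
    have h1 : Tendsto (fun s => U t (U (s - t) ψ)) (𝓝 t) (𝓝 (U t ψ)) := by
      refine ((U t).continuous.tendsto ψ).comp ((hcont0 ψ).comp ?_)
      have : Tendsto (fun s : ℝ => s - t) (𝓝 t) (𝓝 (t - t)) := tendsto_id.sub_const t
      rwa [sub_self] at this
    refine h1.congr fun s => ?_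
    change (U t * U (s - t)) ψ = _
    rw [← hadd, add_sub_cancel]
  have hder : ∀ φ, HasDerivAt (fun t => U t (R φ)) (-I • (φ - R φ)) 0 := fun φ => by
    rw [hasDerivAt_iff_isLittleO, Asymptotics.isLittleO_iff]
    intro c hc0
    obtain ⟨x, hx⟩ := hdense.exists_dist_lt φ (show 0 < c / 8 by positivity)
    have : ∀ᶠ t in 𝓝 (0 : ℝ), |t| < c / (16 * (‖x‖ + 1)) := by
      have h := Metric.ball_mem_nhds (0 : ℝ) (show 0 < c / (16 * (‖x‖ + 1)) by positivity)
      filter_upwards [h] with t ht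
      simpa using ht
    filter_upwards [this] with t ht
    have e : U t (R φ) - U 0 (R φ) - (t - 0) • (-I • (φ - R φ))
        = (A t - R + (I * t) • (1 - R)) φ := by
      rw [hUR, hUR, hA0]
      simp only [add_apply, sub_apply,
        smul_apply, one_apply_eq_self, sub_zero, mul_smul,
        neg_smul, smul_neg, sub_neg_eq_add, RCLike.real_smul_eq_coe_smul (K := ℂ)]
      rw [smul_comm]; rfl
    rw [e, sub_zero, Real.norm_eq_abs]
    set B := A t - R + (I * t) • (1 - R) with hB
    have h1 : ‖B (φ - R x)‖ ≤ 4 * |t| * (c / 8) :=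
      (B.le_of_opNorm_le (hB1 t) _).trans (by gcongr; rw [← dist_eq_norm]; exact hx.le)
    have h2 : ‖(B * R) x‖ ≤ 8 * t ^ 2 * ‖x‖ := (B * R).le_of_opNorm_le (hB3 t) x
    have h3 : B φ = B (φ - R x) + (B * R) x := by
      rw [map_sub]; change _ = _ - _ + B (R x); abel
    rw [h3]
    refine (norm_add_le _ _).trans ?_
    have h4 : |t| * (16 * (‖x‖ + 1)) < c := by rwa [lt_div_iff₀ (by positivity)] at ht
    have h5 : 8 * t ^ 2 * ‖x‖ ≤ |t| * (c / 2) := by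
      rw [← sq_abs t]; nlinarith [abs_nonneg t, norm_nonneg x]
    linarith
  refine ⟨U, hzero, hadd, hnm, hcont, fun ψ φ => ⟨fun h => ?_, fun h => ?_⟩⟩
  · have := hder (ψ + φ)
    rwa [← h, add_sub_cancel_left] at this
  · have key : ∀ η, inner ℂ (R η) φ = inner ℂ (η - R η) ψ := fun η => by
      have h1 : HasDerivAt (fun t => inner ℂ (R η) (U t ψ)) (inner ℂ (R η) (-I • φ)) 0 := by
        have := ((innerSL ℂ (R η)).hasFDerivAt (x := U 0 ψ)).restrictScalars ℝ
          |>.comp_hasDerivAt 0 h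
        exact this
      have h2 : HasDerivAt (fun t => U (-t) (R η)) (I • (η - R η)) 0 := by
        have h0 := hder η
        have := HasDerivAt.scomp (h := fun t : ℝ => -t) (0 : ℝ) (by simpa using h0) (hasDerivAt_neg 0)
        simpa [Function.comp_def] using this
      have h3 : HasDerivAt (fun t => inner ℂ (U (-t) (R η)) ψ) (inner ℂ (I • (η - R η)) ψ) 0 := by
        have := h2.inner ℂ (hasDerivAt_const (0 : ℝ) ψ)
        simpa only [inner_zero_right, zero_add] using this
      have h4 : inner ℂ (R η) (-I • φ) = inner ℂ (I • (η - R η)) ψ :=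
        h1.unique (by simpa only [hneg] using h3)
      rw [inner_smul_right, inner_smul_left, conj_I] at h4
      exact mul_left_cancel₀ (neg_ne_zero.2 I_ne_zero) h4
    refine ext_inner_left ℂ fun η => ?_
    rw [← hsymm, inner_add_right, key, inner_sub_left]
    ring
theorem exists_resolvent {E K : Type*} [NormedAddCommGroup E] [InnerProductSpace ℂ E]
    [CompleteSpace E] [NormedAddCommGroup K] [InnerProductSpace ℂ K] [CompleteSpace K]
    (G : Submodule ℂ (WithLp 2 (E × K))) (hG : IsClosed (G : Set (WithLp 2 (E × K))))
    (hd : ∀ x : E, (∀ p ∈ G, inner ℂ p.fst x = 0) → x = 0) :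
    ∃ R : E →L[ℂ] E, IsSelfAdjoint R ∧ ‖R‖ ≤ 1 ∧ (∀ x, R x = 0 → x = 0) ∧
      ∀ u η, u = R (u + η) ↔
        ∃ k, WithLp.toLp 2 (u, k) ∈ G ∧ ∀ p ∈ G, inner ℂ p.snd k = inner ℂ p.fst η := by
  have : CompleteSpace G := hG.completeSpace_coe
  let J : E →ₗᵢ[ℂ] WithLp 2 (E × K) :=
    ⟨(WithLp.linearEquiv 2 ℂ (E × K)).symm.toLinearMap ∘ₗ LinearMap.inl ℂ E K, fun x => by
      simp⟩
  have hJ : ∀ x, J x = WithLp.toLp 2 (x, 0) := fun x => rfl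
  have hJi : ∀ (x : E) (p : WithLp 2 (E × K)), inner ℂ p (J x) = inner ℂ p.fst x := fun x p => by
    rw [hJ, WithLp.prod_inner_apply]; simp
  let P := G.starProjection
  let R : E →L[ℂ] E := J.toContinuousLinearMap.adjoint ∘L P ∘L J.toContinuousLinearMap
  have hadj : ∀ p, J.toContinuousLinearMap.adjoint p = p.fst := fun p => by
    refine ext_inner_left ℂ fun x => ?_
    rw [ContinuousLinearMap.adjoint_inner_right]
    change inner ℂ (J x) p = _
    rw [← inner_conj_symm, hJi, inner_conj_symm]
  have hR : ∀ x, R x = (P (J x)).fst := fun x => hadj _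
  have hPmem : ∀ x, P x ∈ G := fun x => Submodule.starProjection_apply_mem _ _
  refine ⟨R, ?_, ?_, ?_, ?_⟩
  · have hP : IsSelfAdjoint P := isSelfAdjoint_starProjection G
    exact hP.adjoint_conj J.toContinuousLinearMap
  · refine ContinuousLinearMap.opNorm_le_bound _ zero_le_one fun x => ?_
    rw [one_mul]
    calc ‖R x‖ ≤ ‖P (J x)‖ := by
          rw [hR]; exact WithLp.norm_fst_le E (P (J x))
      _ ≤ ‖J x‖ := G.norm_starProjection_apply_le _
      _ = ‖x‖ := J.norm_map x
  · intro x hx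
    refine hd x fun p hp => ?_
    rw [← hJi]
    have h1 : P (J x) = 0 := by
      have : inner ℂ (P (J x)) (P (J x)) = 0 := by
        have h2 : inner ℂ (P (J x)) (P (J x)) = inner ℂ (P (J x)) (J x) := by
          have h4 := (Submodule.mem_orthogonal _ _).1 (G.sub_starProjection_mem_orthogonal (J x)) _
            (hPmem (J x))
          rw [inner_sub_right, sub_eq_zero] at h4
          exact h4.symm
        rw [h2, hJi, ← hR, hx, inner_zero_left]
      exact inner_self_eq_zero.1 this
    have h3 := G.sub_starProjection_mem_orthogonal (J x)
    have h4 := (Submodule.mem_orthogonal _ _).1 h3 p hp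
    change inner ℂ p (J x - P (J x)) = 0 at h4
    rwa [h1, sub_zero] at h4
  · intro u η
    constructor
    · intro h
      refine ⟨(P (J (u + η))).snd, ?_, fun p hp => ?_⟩
      · have : WithLp.toLp 2 (u, (P (J (u + η))).snd) = P (J (u + η)) := by
          rw [hR] at h
          generalize P (J (u + η)) = q at h
          subst h; rfl
        rw [this]; exact hPmem _
      · have h3 := G.sub_starProjection_mem_orthogonal (J (u + η))
        have h4 := (Submodule.mem_orthogonal _ _).1 h3 p hp
        rw [inner_sub_right, hJi, WithLp.prod_inner_apply] at h4
        change _ - (inner ℂ p.fst (P (J (u + η))).fst + inner ℂ p.snd (P (J (u + η))).snd) = 0 at h4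
        rw [← hR, ← h, inner_add_right] at h4
        linear_combination -h4
    · rintro ⟨k, hk, h⟩
      have : P (J (u + η)) = WithLp.toLp 2 (u, k) := by
        refine Submodule.eq_starProjection_of_mem_of_inner_eq_zero hk fun p hp => ?_
        rw [← inner_conj_symm, inner_sub_right, hJi, WithLp.prod_inner_apply]
        change (starRingEnd ℂ) (_ - (inner ℂ p.fst u + inner ℂ p.snd k)) = 0
        rw [inner_add_right, h p hp]; simp
      rw [hR, this]; rfl

lemma exists_pairing (g : Plane → ℂ) (hg : Continuous g) (hc : HasCompactSupport g) :
    ∃ a : L2Plane, ∀ ψ : L2Plane, ∫ q, ψ q * g q = inner ℂ a ψ := by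
  have hm : MemLp (fun q => (starRingEnd ℂ) (g q)) 2 (volume : Measure Plane) :=
    (continuous_conj.comp hg).memLp_of_hasCompactSupport (hc.comp_left (by simp))
  refine ⟨hm.toLp, fun ψ => ?_⟩
  rw [L2.inner_def]
  refine integral_congr_ae ?_
  filter_upwards [hm.coeFn_toLp] with q hq
  rw [hq, RCLike.inner_apply]; simp

lemma hasWeakPartial_iff (i : Fin 2) : ∃ S : Set (L2Plane × L2Plane),
    ∀ ψ η, HasWeakPartial i ψ η ↔ ∀ a ∈ S, inner ℂ a.1 ψ = -inner ℂ a.2 η := by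
  have h1 : ∀ χ : {χ : Plane → ℂ // ContDiff ℝ ∞ χ ∧ HasCompactSupport χ},
      ∃ a : L2Plane, ∀ ψ : L2Plane,
        ∫ q, ψ q * fderiv ℝ χ.1 q (EuclideanSpace.single i 1) = inner ℂ a ψ := fun χ =>
    exists_pairing _ ((χ.2.1.continuous_fderiv (by simp)).clm_apply continuous_const)
      ((χ.2.2.fderiv ℝ).comp_left (g := fun L : Plane →L[ℝ] ℂ => L (EuclideanSpace.single i 1)) rfl)
  have h2 : ∀ χ : {χ : Plane → ℂ // ContDiff ℝ ∞ χ ∧ HasCompactSupport χ},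
      ∃ a : L2Plane, ∀ ψ : L2Plane, ∫ q, ψ q * χ.1 q = inner ℂ a ψ := fun χ =>
    exists_pairing _ χ.2.1.continuous χ.2.2
  choose a ha using h1
  choose b hb using h2
  refine ⟨Set.range fun χ => (a χ, b χ), fun ψ η => ⟨?_, fun h χ hχ hc => ?_⟩⟩
  · rintro h _ ⟨χ, rfl⟩
    simp only [← ha, ← hb]
    exact h χ.1 χ.2.1 χ.2.2
  · have := h _ ⟨⟨χ, hχ, hc⟩, rfl⟩
    simp only [← ha, ← hb] at this
    exact this

lemma IsFormElement.zero (Γ : Set Plane) : IsFormElement Γ 0 0 0 := by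
  refine ⟨fun i => ?_, ?_⟩
  · obtain ⟨S, hS⟩ := hasWeakPartial_iff i
    simp [hS]
  · filter_upwards [Lp.coeFn_zero ℂ 2 (volume : Measure Plane)] with q _
    simp

lemma IsFormElement.add {Γ : Set Plane} {ψ D w ψ' D' w'} (h : IsFormElement Γ ψ D w)
    (h' : IsFormElement Γ ψ' D' w') : IsFormElement Γ (ψ + ψ') (D + D') (w + w') := by
  refine ⟨fun i => ?_, ?_⟩
  · obtain ⟨S, hS⟩ := hasWeakPartial_iff i
    have h1 := h.weak i
    have h2 := h'.weak i
    rw [hS] at h1 h2 ⊢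
    intro a ha
    rw [Pi.add_apply, inner_add_right, inner_add_right, h1 a ha, h2 a ha]; ring
  · filter_upwards [Lp.coeFn_add ψ ψ', Lp.coeFn_add w w', h.dist, h'.dist] with q e1 e2 e3 e4
    rw [e1, e2, Pi.add_apply, Pi.add_apply, e3, e4]; ring

lemma IsFormElement.smul {Γ : Set Plane} {ψ D w} (c : ℂ) (h : IsFormElement Γ ψ D w) :
    IsFormElement Γ (c • ψ) (c • D) (c • w) := by
  refine ⟨fun i => ?_, ?_⟩
  · obtain ⟨S, hS⟩ := hasWeakPartial_iff i
    have h1 := h.weak i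
    rw [hS] at h1 ⊢
    intro a ha
    rw [Pi.smul_apply, inner_smul_right, inner_smul_right, h1 a ha]; ring
  · filter_upwards [Lp.coeFn_smul c ψ, Lp.coeFn_smul c w, h.dist] with q e1 e2 e3
    rw [e1, e2, Pi.smul_apply, Pi.smul_apply, e3, smul_eq_mul, smul_eq_mul]; ring

lemma isClosed_formElement (Γ : Set Plane) :
    IsClosed {t : L2Plane × (Fin 2 → L2Plane) × L2Plane | IsFormElement Γ t.1 t.2.1 t.2.2} := by
  have h0 : {t : L2Plane × (Fin 2 → L2Plane) × L2Plane | IsFormElement Γ t.1 t.2.1 t.2.2} =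
      {t | ∀ i, HasWeakPartial i t.1 (t.2.1 i)} ∩
        {t | ∀ᵐ q, t.2.2 q = (Metric.infDist q Γ : ℂ) * t.1 q} := by
    ext t; exact ⟨fun h => ⟨h.1, h.2⟩, fun h => ⟨h.1, h.2⟩⟩
  rw [h0]
  refine IsClosed.inter ?_ ?_
  · choose S hS using hasWeakPartial_iff
    simp only [hS, Set.ofPred_forall]
    refine isClosed_iInter fun i => isClosed_iInter fun a => isClosed_iInter fun _ => ?_
    exact isClosed_eq (by fun_prop) (by fun_prop)
  · refine IsSeqClosed.isClosed fun u t hu ht => ?_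
    have l1 : Tendsto (fun k => (u k).1) atTop (𝓝 t.1) :=
      (continuous_fst.tendsto t).comp ht
    have l2 : Tendsto (fun k => (u k).2.2) atTop (𝓝 t.2.2) :=
      ((continuous_snd.comp continuous_snd).tendsto t).comp ht
    obtain ⟨ns, hns, e1⟩ := (tendstoInMeasure_of_tendsto_Lp l1).exists_seq_tendsto_ae
    obtain ⟨ms, hms, e2⟩ :=
      (tendstoInMeasure_of_tendsto_Lp (l2.comp hns.tendsto_atTop)).exists_seq_tendsto_ae
    have e3 : ∀ᵐ q : Plane, ∀ k, (u k).2.2 q = (Metric.infDist q Γ : ℂ) * (u k).1 q :=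
      ae_all_iff.2 hu
    change ∀ᵐ q, _
    filter_upwards [e1, e2, e3] with q h1 h2 h3
    have h4 := (h1.comp hms.tendsto_atTop).const_mul (Metric.infDist q Γ : ℂ)
    refine tendsto_nhds_unique h2 (h4.congr fun k => ?_)
    exact (h3 _).symm

lemma isFormElement_of_test (Γ : Set Plane) (g : Plane → ℂ) (hg : ContDiff ℝ ∞ g)
    (hc : HasCompactSupport g) (ψ : L2Plane) (hψ : ψ =ᵐ[volume] g) :
    ∃ D w, IsFormElement Γ ψ D w := by
  have hcont : ∀ i : Fin 2, Continuous fun q => fderiv ℝ g q (EuclideanSpace.single i 1) :=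
    fun i => (hg.continuous_fderiv (by simp)).clm_apply continuous_const
  have hD : ∀ i : Fin 2, MemLp (fun q => fderiv ℝ g q (EuclideanSpace.single i 1)) 2
      (volume : Measure Plane) := fun i =>
    (hcont i).memLp_of_hasCompactSupport
      ((hc.fderiv ℝ).comp_left (g := fun L : Plane →L[ℝ] ℂ => L (EuclideanSpace.single i 1)) rfl)
  have hw : MemLp (fun q => (Metric.infDist q Γ : ℂ) * g q) 2 (volume : Measure Plane) :=
    Continuous.memLp_of_hasCompactSupport
      ((continuous_ofReal.comp (Metric.continuous_infDist_pt Γ)).mul hg.continuous) hc.mul_left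
  refine ⟨fun i => (hD i).toLp, hw.toLp, fun i χ hχ hχc => ?_, ?_⟩
  · have e1 : ∫ q, ψ q * fderiv ℝ χ q (EuclideanSpace.single i 1)
        = ∫ q, g q * fderiv ℝ χ q (EuclideanSpace.single i 1) :=
      integral_congr_ae (by filter_upwards [hψ] with q h; rw [h])
    have e2 : ∫ q, ((hD i).toLp : L2Plane) q * χ q
        = ∫ q, fderiv ℝ g q (EuclideanSpace.single i 1) * χ q :=
      integral_congr_ae (by filter_upwards [(hD i).coeFn_toLp] with q h; rw [h])
    have hχ' : Continuous fun q => fderiv ℝ χ q (EuclideanSpace.single i 1) :=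
      (hχ.continuous_fderiv (by simp)).clm_apply continuous_const
    rw [e1, e2]
    refine integral_mul_fderiv_eq_neg_fderiv_mul_of_integrable ?_ ?_ ?_
      (fun x _ => hg.differentiable (by simp) x) (fun x _ => hχ.differentiable (by simp) x)
    · exact ((hcont i).mul hχ.continuous).integrable_of_hasCompactSupport hχc.mul_left
    · exact (hg.continuous.mul hχ').integrable_of_hasCompactSupport hc.mul_right
    · exact (hg.continuous.mul hχ.continuous).integrable_of_hasCompactSupport hc.mul_right
  · filter_upwards [hψ, hw.coeFn_toLp] with q h1 h2
    rw [h2, h1]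

theorem hamiltonian_resolvent (Γ : Set Plane) {ε : ℝ} (hε : 0 < ε) :
    ∃ R : L2Plane →L[ℂ] L2Plane, IsSelfAdjoint R ∧ ‖R‖ ≤ 1 ∧ (∀ x, R x = 0 → x = 0) ∧
      ∀ ψ η, IsHamiltonian Γ ε ψ η ↔ ψ = R (ψ + η) := by
  let Kt := WithLp 2 (PiLp 2 (fun _ : Fin 2 => L2Plane) × L2Plane)
  let a : ℂ := ((√2 : ℝ) : ℂ)
  have ha : a ≠ 0 := by simp [a]
  have haa : a * a = 2 := by
    simp only [a]; rw [← ofReal_mul, Real.mul_self_sqrt (by norm_num)]; simp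
  have hca : (starRingEnd ℂ) a = a := conj_ofReal _
  have he : (ε : ℂ) ≠ 0 := ofReal_ne_zero.2 hε.ne'
  let G : Submodule ℂ (WithLp 2 (L2Plane × Kt)) :=
    { carrier := {p | IsFormElement Γ p.fst (a • fun i => p.snd.fst i) ((a * ε) • p.snd.snd)}
      zero_mem' := by
        have := (IsFormElement.zero Γ).smul a
        refine Eq.mp ?_ (IsFormElement.zero Γ)
        change _ = IsFormElement Γ 0 (a • 0) ((a * ε) • 0)
        rw [smul_zero, smul_zero]
      add_mem' := fun {p p'} h h' => by
        have := IsFormElement.add h h'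
        rwa [← smul_add, ← smul_add] at this
      smul_mem' := fun c p h => by
        have := IsFormElement.smul c h
        rwa [smul_comm c a, smul_comm c (a * (ε : ℂ))] at this }
  have hmem : ∀ p, p ∈ G ↔
      IsFormElement Γ p.fst (a • fun i => p.snd.fst i) ((a * ε) • p.snd.snd) := fun p => Iff.rfl
  have hlift : ∀ ψ D w, IsFormElement Γ ψ D w → ∃ k : Kt, WithLp.toLp 2 (ψ, k) ∈ G ∧
      (a • fun i => k.fst i) = D ∧ (a * ε) • k.snd = w := fun ψ D w h => by
    let k : Kt := WithLp.toLp 2 (WithLp.toLp 2 (fun i => a⁻¹ • D i), (a * (ε : ℂ))⁻¹ • w)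
    have e1 : (a • fun i => k.fst i) = D := funext fun i => smul_inv_smul₀ ha (D i)
    have e2 : (a * ε) • k.snd = w := smul_inv_smul₀ (mul_ne_zero ha he) w
    refine ⟨k, ?_, e1, e2⟩
    rw [hmem]
    change IsFormElement Γ ψ (a • fun i => k.fst i) ((a * ε) • k.snd)
    rwa [e1, e2]
  have hG : IsClosed (G : Set (WithLp 2 (L2Plane × Kt))) := by
    let F : WithLp 2 (L2Plane × Kt) → L2Plane × (Fin 2 → L2Plane) × L2Plane :=
      fun p => (p.fst, (a • fun i => p.snd.fst i), (a * ε) • p.snd.snd)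
    have hF : Continuous F := by
      have c1 : Continuous fun p : WithLp 2 (L2Plane × Kt) => p.fst := WithLp.continuous_fst ..
      have c2 : Continuous fun p : WithLp 2 (L2Plane × Kt) => p.snd := WithLp.continuous_snd ..
      have c3 : Continuous fun k : Kt => k.fst := WithLp.continuous_fst ..
      have c4 : Continuous fun k : Kt => k.snd := WithLp.continuous_snd ..
      have c5 : Continuous fun k : PiLp 2 (fun _ : Fin 2 => L2Plane) => WithLp.ofLp k :=
        PiLp.continuous_ofLp ..
      exact c1.prodMk (((c5.comp (c3.comp c2)).const_smul a).prodMk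
        ((c4.comp c2).const_smul (a * ε)))
    exact (isClosed_formElement Γ).preimage hF
  have hd : ∀ x : L2Plane, (∀ p ∈ G, inner ℂ p.fst x = 0) → x = 0 := by
    intro x hx
    have hdense := Lp.dense_hasCompactSupport_contDiff (E := Plane) (F := ℂ) (p := 2)
      (μ := (volume : Measure Plane)) (by simp)
    have : ∀ y : L2Plane, inner ℂ y x = 0 := by
      refine fun y => hdense.induction (P := fun y => inner ℂ y x = 0) ?_
        (isClosed_eq (by fun_prop) continuous_const) y
      rintro y ⟨g, hyg, hgc, hg⟩
      obtain ⟨D, w, h⟩ := isFormElement_of_test Γ g hg hgc y hyg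
      obtain ⟨k, hk, -⟩ := hlift y D w h
      exact hx _ hk
    exact inner_self_eq_zero.1 (this x)
  obtain ⟨R, h1, h2, h3, h4⟩ := exists_resolvent G hG hd
  refine ⟨R, h1, h2, h3, fun ψ η => ?_⟩
  rw [h4]
  have hin : ∀ (k k' : Kt), inner ℂ k' k = (1 / 2) * ∑ i, inner ℂ ((a • fun i => k'.fst i) i)
      ((a • fun i => k.fst i) i) + 1 / (2 * (ε : ℂ) ^ 2) *
        inner ℂ ((a * ε) • k'.snd) ((a * ε) • k.snd) := fun k k' => by
    rw [WithLp.prod_inner_apply]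
    have : inner ℂ (WithLp.ofLp k').1 (WithLp.ofLp k).1 = ∑ i, inner ℂ (k'.fst i) (k.fst i) :=
      PiLp.inner_apply _ _
    rw [this]
    simp only [Pi.smul_apply, inner_smul_left, inner_smul_right, map_mul, hca, conj_ofReal]
    rw [← Finset.mul_sum, ← Finset.mul_sum]
    change _ + inner ℂ k'.snd k.snd = _
    field_simp
    rw [← sq] at haa
    linear_combination (-(∑ i, inner ℂ (k'.fst i) (k.fst i)) - inner ℂ k'.snd k.snd) * haa
  constructor
  · rintro ⟨D, w, hf, h⟩
    obtain ⟨k, hk, e1, e2⟩ := hlift ψ D w hf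
    refine ⟨k, hk, fun p hp => ?_⟩
    rw [hin, e1, e2]
    exact h _ _ _ hp
  · rintro ⟨k, hk, h⟩
    refine ⟨_, _, hk, fun χ D' w' h' => ?_⟩
    obtain ⟨k', hk', e1, e2⟩ := hlift χ D' w' h'
    have := h _ hk'
    rw [← e1, ← e2]
    exact (hin k k').symm.trans this

/-- For `ε > 0` the Hamiltonian does generate a unitary group. -/
theorem isUnitaryGroup_hamiltonian (Γ : Set Plane) {ε : ℝ} (hε : 0 < ε) :
    IsUnitaryGroup (IsHamiltonian Γ ε) (unitaryGroup (IsHamiltonian Γ ε)) := by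
  obtain ⟨R, h1, h2, h3, h4⟩ := hamiltonian_resolvent Γ hε
  have h5 : IsHamiltonian Γ ε = fun ψ η => ψ = R (ψ + η) := by
    funext ψ η; exact propext (h4 ψ η)
  have h6 := exists_unitaryGroup R h1 h2 h3
  rw [← h5] at h6
  exact Classical.epsilon_spec h6

/-! ### The transverse modes -/

/-- The normalized `n`-th eigenfunction `Φ_n^ε` of the harmonic oscillator
`-(1/2) d²/dy² + y²/(2 ε²)`, with eigenvalue `(n + 1/2)/ε`:
`Φ_n^ε(y) = (n! √(π ε))^(-1/2) He_n(√(2/ε) y) exp(-y²/(2 ε))`, where `He_n` is the `n`-th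
Hermite polynomial, orthogonal for the weight `exp(-u²/2)` (for `ε ≤ 0` it is zero). -/
noncomputable def oscillatorState (ε : ℝ) (n : ℕ) (y : ℝ) : ℝ :=
  (√(n.factorial * √(Real.pi * ε)))⁻¹ * Polynomial.aeval (√(2 / ε) * y) (Polynomial.hermite n) *
    Real.exp (-(y ^ 2) / (2 * ε))

lemma derivative_hermite_succ (n : ℕ) :
    Polynomial.derivative (Polynomial.hermite (n + 1)) = ((n + 1 : ℕ) : Polynomial ℤ) * Polynomial.hermite n := by
  induction n with
  | zero => simp
  | succ k ih =>
    rw [Polynomial.hermite_succ (k + 1), Polynomial.derivative_sub, Polynomial.derivative_mul, ih,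
      Polynomial.derivative_mul, Polynomial.derivative_natCast, Polynomial.derivative_X]
    have := Polynomial.hermite_succ k
    rw [this]
    push_cast; ring

lemma hermite_ode (n : ℕ) :
    Polynomial.derivative (Polynomial.derivative (Polynomial.hermite n))
      - Polynomial.X * Polynomial.derivative (Polynomial.hermite n)
      + (n : Polynomial ℤ) * Polynomial.hermite n = 0 := by
  cases n with
  | zero => simp
  | succ k =>
    rw [derivative_hermite_succ, Polynomial.derivative_mul, Polynomial.derivative_natCast,
      Polynomial.hermite_succ k]
    ring

theorem oscillatorState_eigen {ε : ℝ} (hε : 0 < ε) (n : ℕ) (y : ℝ) :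
    -(1 / 2) * deriv (deriv (oscillatorState ε n)) y
      + 1 / (2 * ε ^ 2) * y ^ 2 * oscillatorState ε n y
      = (n + 1 / 2) / ε * oscillatorState ε n y := by
  set c := (√(n.factorial * √(Real.pi * ε)))⁻¹
  set b := √(2 / ε)
  have hb : b ^ 2 = 2 / ε := Real.sq_sqrt (by positivity)
  have hP : ∀ (P : Polynomial ℤ) y, HasDerivAt
      (fun y => c * Polynomial.aeval (b * y) P * Real.exp (-(y ^ 2) / (2 * ε)))
      (c * (b * Polynomial.aeval (b * y) (Polynomial.derivative P)
        - y / ε * Polynomial.aeval (b * y) P) * Real.exp (-(y ^ 2) / (2 * ε))) y := fun P y => by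
    have h1 : HasDerivAt (fun y => Polynomial.aeval (b * y) P)
        (Polynomial.aeval (b * y) (Polynomial.derivative P) * b) y := by
      have := (P.hasDerivAt_aeval (b * y)).comp y ((hasDerivAt_id y).const_mul b)
      simpa [Function.comp_def] using this
    have h2 : HasDerivAt (fun y : ℝ => Real.exp (-(y ^ 2) / (2 * ε)))
        (Real.exp (-(y ^ 2) / (2 * ε)) * (-(2 * y) / (2 * ε))) y := by
      have := (((hasDerivAt_pow 2 y).neg).div_const (2 * ε)).exp
      simpa using this
    have := (h1.const_mul c).mul h2
    refine this.congr_deriv ?_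
    field_simp
    ring
  have hP0 := hP (Polynomial.hermite n)
  have e1 : deriv (oscillatorState ε n) = fun y =>
      c * (b * Polynomial.aeval (b * y) (Polynomial.derivative (Polynomial.hermite n))
        - y / ε * Polynomial.aeval (b * y) (Polynomial.hermite n)) *
        Real.exp (-(y ^ 2) / (2 * ε)) := funext fun y => (hP0 y).deriv
  have e2 : deriv (deriv (oscillatorState ε n)) y = c * (
      b ^ 2 * Polynomial.aeval (b * y)
        (Polynomial.derivative (Polynomial.derivative (Polynomial.hermite n)))
      - 2 * (y / ε) * (b * Polynomial.aeval (b * y) (Polynomial.derivative (Polynomial.hermite n)))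
      + ((y / ε) ^ 2 - 1 / ε) * Polynomial.aeval (b * y) (Polynomial.hermite n)) *
        Real.exp (-(y ^ 2) / (2 * ε)) := by
    have h1 := ((hP (Polynomial.derivative (Polynomial.hermite n)) y).const_mul b).sub
      (((hasDerivAt_id y).div_const ε).mul (hP0 y))
    rw [e1]
    refine HasDerivAt.deriv ((h1.congr_deriv ?_).congr_of_eventuallyEq
      (Eventually.of_forall fun z => ?_))
    · simp only [id]; ring
    · simp only [id, Pi.sub_apply, Pi.mul_apply]; ring
  have ode := congrArg (Polynomial.aeval (b * y)) (hermite_ode n)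
  simp only [map_add, map_sub, map_mul, map_zero, Polynomial.aeval_X, map_natCast] at ode
  rw [e2]
  simp only [oscillatorState]
  rw [hb]
  have hε' := hε.ne'
  change _ + _ * (c * Polynomial.aeval (b * y) (Polynomial.hermite n) * _)
    = _ * (c * Polynomial.aeval (b * y) (Polynomial.hermite n) * _)
  generalize c = c
  field_simp
  linear_combination (-2 * c * ε) * ode

lemma memLp_gaussian_poly (P : Polynomial ℝ) {b : ℝ} (hb : 0 < b) :
    MemLp (fun y : ℝ => P.eval y * Real.exp (-b * y ^ 2)) 2 volume := by
  induction P using Polynomial.induction_on' with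
  | add p q hp hq =>
    simp only [Polynomial.eval_add, add_mul]; exact hp.add hq
  | monomial k a =>
    rw [memLp_two_iff_integrable_sq_norm (by fun_prop)]
    have h := (integrable_rpow_mul_exp_neg_mul_sq (show 0 < 2 * b by positivity)
      (s := ((2 * k : ℕ) : ℝ)) (by have : (0:ℝ) ≤ ((2 * k : ℕ) : ℝ) := by positivity
                                   linarith)).const_mul (a ^ 2)
    refine h.congr (ae_of_all _ fun y => ?_)
    simp only [Polynomial.eval_monomial, Real.norm_eq_abs, sq_abs, Real.rpow_natCast]
    rw [mul_pow, ← Real.exp_nat_mul]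
    push_cast
    ring_nf

theorem memLp_oscillatorState (ε : ℝ) (n : ℕ) :
    MemLp (fun y => (oscillatorState ε n y : ℂ)) 2 volume := by
  suffices h : MemLp (oscillatorState ε n) 2 volume from h.ofReal
  by_cases hε : 0 < ε
  · have h := (memLp_gaussian_poly
      (((Polynomial.hermite n).map (Int.castRingHom ℝ)).comp (Polynomial.C √(2 / ε) * Polynomial.X))
      (show 0 < (2 * ε)⁻¹ by positivity)).const_mul (√(n.factorial * √(Real.pi * ε)))⁻¹
    refine h.ae_eq (ae_of_all _ fun y => ?_)
    have e1 : (((Polynomial.hermite n).map (Int.castRingHom ℝ)).comp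
        (Polynomial.C √(2 / ε) * Polynomial.X)).eval y
        = Polynomial.aeval (√(2 / ε) * y) (Polynomial.hermite n) := by
      rw [Polynomial.eval_comp, Polynomial.eval_map]; simp [Polynomial.aeval_def]
    have e2 : -(2 * ε)⁻¹ * y ^ 2 = -(y ^ 2) / (2 * ε) := by ring
    simp only [e1, e2]
    rw [oscillatorState, mul_assoc]
  · have : √(Real.pi * ε) = 0 :=
      Real.sqrt_eq_zero_of_nonpos (mul_nonpos_of_nonneg_of_nonpos Real.pi_pos.le (not_lt.1 hε))
    have h0 : oscillatorState ε n = 0 := by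
      funext y; simp [oscillatorState, this]
    rw [h0]; exact MemLp.zero


/-! ### The coordinates attached to an edge -/

/-- The rotation by a right angle. -/
noncomputable def rot (d : Plane) : Plane := !₂[-d 1, d 0]

/-- The point with coordinates `z = (x, y)` in the frame with origin `p`, first axis along the unit
vector `d` and second axis orthogonal to it. -/
noncomputable def framePoint (p d : Plane) (z : ℝ × ℝ) : Plane := p + z.1 • d + z.2 • rot d

/-- The coordinates `(x, y)` of a point `q` in the same frame. -/
noncomputable def frameCoord (p d q : Plane) : ℝ × ℝ :=
  (inner ℝ d (q - p), inner ℝ (rot d) (q - p))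

lemma orthonormal_frame (d : Plane) (hd : ‖d‖ = 1) : Orthonormal ℝ ![d, rot d] := by
  have h : d 0 ^ 2 + d 1 ^ 2 = 1 := by
    have := EuclideanSpace.real_norm_sq_eq d
    rw [hd] at this; simpa using this.symm
  have h2 : ‖rot d‖ = 1 := by
    rw [EuclideanSpace.norm_eq, Real.sqrt_eq_one]; simp [rot]; linarith
  have h3 : inner ℝ d (rot d) = 0 := by
    simp [PiLp.inner_apply, rot, Fin.sum_univ_two]; ring
  refine ⟨fun i => ?_, fun i j hij => ?_⟩
  · fin_cases i
    · exact hd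
    · exact h2
  · fin_cases i <;> fin_cases j
    · exact absurd rfl hij
    · exact h3
    · exact (real_inner_comm _ _).trans h3
    · exact absurd rfl hij

lemma exists_frameBasis (d : Plane) (hd : ‖d‖ = 1) :
    ∃ b : OrthonormalBasis (Fin 2) ℝ Plane, ⇑b = ![d, rot d] := by
  have ho := orthonormal_frame d hd
  refine ⟨(basisOfOrthonormalOfCardEqFinrank ho (by simp)).toOrthonormalBasis (by simpa using ho), ?_⟩
  rw [Module.Basis.coe_toOrthonormalBasis, coe_basisOfOrthonormalOfCardEqFinrank]

lemma measurePreserving_framePoint (p d : Plane) (hd : ‖d‖ = 1) :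
    MeasurePreserving (framePoint p d) (volume : Measure (ℝ × ℝ)) (volume : Measure Plane) := by
  have h1 := (volume_preserving_finTwoArrow ℝ).symm
  have h2 := (PiLp.volume_preserving_toLp (Fin 2))
  obtain ⟨b, hb⟩ := exists_frameBasis d hd
  have h3 := b.measurePreserving_repr_symm
  have h4 := measurePreserving_add_left (volume : Measure Plane) p
  have := h4.comp (h3.comp (h2.comp h1))
  convert this using 1
  funext z
  have : b.repr.symm (WithLp.toLp 2 ![z.1, z.2])
      = z.1 • d + z.2 • rot d := by
    have := b.sum_repr_symm (WithLp.toLp 2 ![z.1, z.2])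
    rw [← this]; simp [hb]
  change p + z.1 • d + z.2 • rot d = p + b.repr.symm (WithLp.toLp 2 ![z.1, z.2])
  rw [this, add_assoc]

lemma frameCoord_framePoint (p d : Plane) (hd : ‖d‖ = 1) (z : ℝ × ℝ) :
    frameCoord p d (framePoint p d z) = z := by
  have ho := orthonormal_frame d hd
  have h1 : inner ℝ d (rot d) = 0 := ho.2 (show (0 : Fin 2) ≠ 1 by decide)
  have h2 : inner ℝ (rot d) d = 0 := ho.2 (show (1 : Fin 2) ≠ 0 by decide)
  have h3 : ‖rot d‖ = 1 := ho.1 1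
  have e : framePoint p d z - p = z.1 • d + z.2 • rot d := by rw [framePoint]; abel
  rw [frameCoord, e]
  simp only [inner_add_right, inner_smul_right, h1, h2, real_inner_self_eq_norm_sq, hd, h3]
  simp

lemma framePoint_frameCoord (p d : Plane) (hd : ‖d‖ = 1) (q : Plane) :
    framePoint p d (frameCoord p d q) = q := by
  obtain ⟨b, hb⟩ := exists_frameBasis d hd
  have := b.sum_repr' (q - p)
  simp only [hb, Fin.sum_univ_two, Matrix.cons_val_zero, Matrix.cons_val_one] at this
  rw [framePoint, add_assoc, frameCoord, this]; abel

lemma measurePreserving_frameCoord (p d : Plane) (hd : ‖d‖ = 1) :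
    MeasurePreserving (frameCoord p d) (volume : Measure Plane) (volume : Measure (ℝ × ℝ)) := by
  have hc : Measurable (frameCoord p d) := by
    have : Continuous (frameCoord p d) := by unfold frameCoord; fun_prop
    exact this.measurable
  refine ⟨hc, ?_⟩
  have h := measurePreserving_framePoint p d hd
  rw [← h.map_eq, Measure.map_map hc h.measurable]
  have : frameCoord p d ∘ framePoint p d = id := funext (frameCoord_framePoint p d hd)
  rw [this, Measure.map_id]

theorem memLp_productState (p d : Plane) (hd : ‖d‖ = 1) {f g : ℝ → ℂ} (hf : MemLp f 2 volume)
    (hg : MemLp g 2 volume) :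
    MemLp (fun q : Plane => f (frameCoord p d q).1 * g (frameCoord p d q).2) 2 volume := by
  have h : MemLp (fun z : ℝ × ℝ => f z.1 * g z.2) 2 (volume : Measure (ℝ × ℝ)) := by
    rw [memLp_two_iff_integrable_sq_norm]
    · have := (hf.integrable_norm_pow two_ne_zero).mul_prod (hg.integrable_norm_pow two_ne_zero)
      refine this.congr (ae_of_all _ fun z => ?_)
      simp [mul_pow]
    · exact hf.1.comp_fst.mul hg.1.comp_snd
  exact h.comp_measurePreserving (measurePreserving_frameCoord p d hd)

theorem memLp_transverse (p d : Plane) (hd : ‖d‖ = 1) {g : ℝ → ℂ} (hg : MemLp g 2 volume)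
    (ψ : L2Plane) :
    MemLp (fun x : ℝ => ∫ y, (starRingEnd ℂ) (g y) * ψ (framePoint p d (x, y))) 2 volume := by
  have hF : MemLp (fun z : ℝ × ℝ => ψ (framePoint p d z)) 2 (volume.prod volume) :=
    (Lp.memLp ψ).comp_measurePreserving (measurePreserving_framePoint p d hd)
  have hFi := hF.integrable_norm_pow two_ne_zero
  have hg' : MemLp (fun y => (starRingEnd ℂ) (g y)) 2 volume := hg.star
  have hm : AEStronglyMeasurable
      (fun x : ℝ => ∫ y, (starRingEnd ℂ) (g y) * ψ (framePoint p d (x, y))) volume :=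
    AEStronglyMeasurable.integral_prod_right' (hg'.1.comp_snd.mul hF.1)
  rw [memLp_two_iff_integrable_sq_norm hm]
  refine (hFi.integral_prod_left.const_mul (∫ y, ‖g y‖ ^ 2)).mono' (hm.norm.pow 2) ?_
  filter_upwards [hFi.prod_right_ae, hF.1.prodMk_left] with x hx hxm
  have hxl : MemLp (fun y => ψ (framePoint p d (x, y))) 2 volume :=
    (memLp_two_iff_integrable_sq_norm hxm).2 hx
  have h1 : ∫ y, (starRingEnd ℂ) (g y) * ψ (framePoint p d (x, y))
      = inner ℂ hg.toLp hxl.toLp := by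
    rw [L2.inner_def]
    refine integral_congr_ae ?_
    filter_upwards [hg.coeFn_toLp, hxl.coeFn_toLp] with y e1 e2
    rw [e1, e2, RCLike.inner_apply]; ring
  have h2 : ∀ {k : ℝ → ℂ} (hk : MemLp k 2 volume), ‖hk.toLp‖ ^ 2 = ∫ y, ‖k y‖ ^ 2 := by
    intro k hk
    have h3 : ((‖hk.toLp‖ ^ 2 : ℝ) : ℂ) = ((∫ y, ‖k y‖ ^ 2 : ℝ) : ℂ) := by
      rw [← integral_complex_ofReal]
      push_cast
      have := inner_self_eq_norm_sq_to_K (𝕜 := ℂ) hk.toLp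
      refine (Eq.symm this).trans ?_
      rw [L2.inner_def]
      refine integral_congr_ae ?_
      filter_upwards [hk.coeFn_toLp] with y e1
      rw [e1]; exact inner_self_eq_norm_sq_to_K (𝕜 := ℂ) (k y)
    exact_mod_cast h3
  rw [h1, norm_pow, norm_norm, ← h2 hg, ← h2 hxl, ← mul_pow]
  gcongr
  exact norm_inner_le_norm _ _

/-! ### The initial state, its evolution and the transverse components -/

namespace StraightGraph

variable {V E : Type*} (Γ : StraightGraph V E)

/-- The initial state `f(x) Φ_n^ε(y)` in the coordinates `(x, y)` of the edge `j`, with `f` smooth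
and compactly supported in the interior of the edge. -/
noncomputable def initialState (ε : ℝ) (n : ℕ) (j : E) (f : 𝓓(edgeInterval (Γ.length j), ℂ)) :
    L2Plane :=
  (memLp_productState (Γ.pos (Γ.source j)) (Γ.dir j) (Γ.norm_dir j)
    (f.continuous.memLp_of_hasCompactSupport f.hasCompactSupport)
    (memLp_oscillatorState ε n)).toLp

/-- `exp (-i t (H(ε) - E_n/ε))` applied to `ψ₀`, where `E_n = n + 1/2`. -/
noncomputable def evolution (ε : ℝ) (n : ℕ) (t : ℝ) (ψ₀ : L2Plane) : L2Plane :=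
  Complex.exp (I * t * ((n + 1 / 2) / ε)) • unitaryGroup (IsHamiltonian Γ.carrier ε) t ψ₀

/-- The component of `ψ` along the `m`-th transverse mode of the edge `j`:
`x ↦ ∫ Φ_m^ε(y)^* ψ(x, y) dy` in the coordinates `(x, y)` of that edge. -/
noncomputable def transverseComponent (ε : ℝ) (m : ℕ) (j : E) (ψ : L2Plane) : L2Line :=
  MemLp.toLp
    (fun x : ℝ => ∫ y, (starRingEnd ℂ) (oscillatorState ε m y : ℂ) *
      ψ (framePoint (Γ.pos (Γ.source j)) (Γ.dir j) (x, y)))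
    (memLp_transverse (Γ.pos (Γ.source j)) (Γ.dir j) (Γ.norm_dir j) (memLp_oscillatorState ε m) ψ)

end StraightGraph

/-! ### Weak-star convergence -/

/-- The functions `s ε`, for `ε > 0`, and `s₀` belong to `L^∞((0, T), L²(ℝ))`, and `s ε` converges
to `s₀` as `ε → 0` in the weak-star topology, that is when tested with the elements of the predual
`L¹((0, T), L²(ℝ))`. -/
def WeakStarTendsto (T : ℝ) (s : ℝ → ℝ → L2Line) (s₀ : ℝ → L2Line) : Prop :=
  (∀ ε > 0, MemLp (s ε) ⊤ (volume.restrict (Ioo 0 T))) ∧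
  MemLp s₀ ⊤ (volume.restrict (Ioo 0 T)) ∧
  ∀ g : ℝ → L2Line, MemLp g 1 (volume.restrict (Ioo 0 T)) →
    Tendsto (fun ε => ∫ t in Ioo 0 T, inner ℂ (g t) (s ε t)) (𝓝[>] 0)
      (𝓝 (∫ t in Ioo 0 T, inner ℂ (g t) (s₀ t)))

/-! ### A criterion for weak-star convergence -/

section Criterion

variable {H : Type*} [NormedAddCommGroup H] [InnerProductSpace ℂ H]

/-! Write `Ψ_t` for the evolved state and `λ = E_n/ε`. Testing the component `s_j^m(t)` against `v ∈
L²(ℝ)` is the same as testing `Ψ_t` against the product state `v(x) Φ_m^ε(y)` in the frame of the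
edge `j` (`toLp_transverse`). Since `⟨(H(ε) - λ)φ, Ψ_t⟩` is the time derivative of `i⟨φ, Ψ_t⟩`, its
integral over a bounded interval of times is at most `2 ‖φ‖ ‖Ψ_0‖` in modulus
(`IsUnitaryGroup.norm_integral_inner_le`). So if `v Φ_m^ε = (H(ε) - λ) φ_ε + o(1)` with `φ_ε → 0` in
`L²`, all time means of `⟨v, s_j^m⟩` tend to zero. Nothing about the dynamics at the vertices is
needed, and the initial state enters only through a bound on its norm.

Approximate preimages are sought as `φ_ε = c_ε u(x) θ(y) Φ_m^ε(y)` with a cutoff `θ`. By the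
oscillator equation, `H(ε) - λ` acts on them, up to terms of size `O(√ε)` in `L²`, as multiplication
by `(m - n)/ε + (d_Γ² - y²)/(2ε²)`; a factor `|y|` in front of `Φ_m^ε` is itself worth `√ε`
(`exists_approx_preimage`, `norm_remainder_le`). There are two useful choices of `c_ε`. With `c_ε =
2ε²` the limit multiplier is `W(x)²`, where `W(x)` is the distance from `Γ` to the point of
parameter `x` on the line of `j`; this reaches every `v = W² u`. Near a point of the line interior
to an edge contained in that line, `d_Γ = |y|`, and `c_ε = ε/(m - n)` reaches `v = u`; this is where
`m ≠ n` is used.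

A vector `g` orthogonal to all these `v` vanishes a.e. off `Γ` and a.e. near the points of edges
lying in the line. Only vertices and transversal crossings remain, finitely many points, so `g = 0`
(`StraightGraph.eq_zero_of_orthogonal`). The `v` with vanishing means form a closed subspace, hence
all of `L²(ℝ)`, and a uniform bound on `s_j^m` extends the convergence from constants on intervals
to every `g ∈ L¹((0, T), L²(ℝ))` (`tendsto_integral_inner_of_mean`). -/

lemma norm_integral_inner_le {μ : Measure ℝ} [IsFiniteMeasure μ] {C : ℝ} {s : ℝ → H}
    (hb : ∀ t, ‖s t‖ ≤ C) (v : H) :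
    ‖∫ t, inner ℂ v (s t) ∂μ‖ ≤ ‖v‖ * C * μ.real univ := by
  refine norm_integral_le_of_norm_le_const (ae_of_all _ fun t => ?_)
  exact (norm_inner_le_norm _ _).trans (by gcongr; exact hb t)

lemma integrable_inner_left {μ : Measure ℝ} {C : ℝ} {s : ℝ → H}
    (hb : ∀ t, ‖s t‖ ≤ C) (hc : Continuous s) {g : ℝ → H} (hg : Integrable g μ) :
    Integrable (fun t => inner ℂ (g t) (s t)) μ := by
  refine (hg.norm.mul_const C).mono' (hg.1.inner hc.aestronglyMeasurable) (ae_of_all _ fun t => ?_)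
  exact (norm_inner_le_norm _ _).trans (by gcongr; exact hb t)

/-- The vectors against which the means over bounded intervals of time tend to zero. -/
def meanNullSubmodule (s : ℝ → ℝ → H) {C : ℝ} (hb : ∀ ε > 0, ∀ t, ‖s ε t‖ ≤ C)
    (hc : ∀ ε > 0, Continuous (s ε)) : Submodule ℂ H where
  carrier := {v | ∀ a b : ℝ,
    Tendsto (fun ε => ∫ t in Ioo a b, inner ℂ v (s ε t)) (𝓝[>] 0) (𝓝 0)}
  zero_mem' := fun a b => by simp
  add_mem' := fun {v w} hv hw a b => by
    have h := (hv a b).add (hw a b)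
    rw [add_zero] at h
    refine h.congr' ?_
    filter_upwards [self_mem_nhdsWithin] with ε hε
    simp only [inner_add_left]
    exact (integral_add (integrable_inner_left (hb ε hε) (hc ε hε) (integrable_const v))
      (integrable_inner_left (hb ε hε) (hc ε hε) (integrable_const w))).symm
  smul_mem' := fun c v hv a b => by
    have h := (hv a b).const_mul ((starRingEnd ℂ) c)
    rw [mul_zero] at h
    refine h.congr fun ε => ?_
    simp only [inner_smul_left]
    exact (integral_const_mul _ _).symm

/-- This serves two closure arguments: approximating the test vector in `H`, and approximating the
test function in `L¹`. -/
lemma tendsto_zero_of_approx {F : ℝ → ℂ} {l : Filter ℝ}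
    (h : ∀ δ > 0, ∃ G : ℝ → ℂ, Tendsto G l (𝓝 0) ∧ ∀ᶠ ε in l, ‖F ε - G ε‖ ≤ δ) :
    Tendsto F l (𝓝 0) := by
  rw [Metric.tendsto_nhds]
  intro δ hδ
  obtain ⟨G, h1, h2⟩ := h (δ / 2) (by positivity)
  filter_upwards [h2, (Metric.tendsto_nhds.1 h1) (δ / 2) (by positivity)] with ε e1 e2
  rw [dist_zero_right] at e2 ⊢
  calc ‖F ε‖ = ‖(F ε - G ε) + G ε‖ := by rw [sub_add_cancel]
    _ ≤ _ := norm_add_le _ _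
    _ < δ := by linarith

/-- The bound `C` makes `v ↦ ∫ ⟨v, s ε t⟩ dt` Lipschitz with a constant independent of `ε`. -/
lemma isClosed_meanNullSubmodule (s : ℝ → ℝ → H) {C : ℝ} (hb : ∀ ε > 0, ∀ t, ‖s ε t‖ ≤ C)
    (hc : ∀ ε > 0, Continuous (s ε)) : IsClosed (meanNullSubmodule s hb hc : Set H) := by
  refine isClosed_of_closure_subset fun v hv a b => tendsto_zero_of_approx fun δ hδ => ?_
  have hC : 0 ≤ C := (norm_nonneg _).trans (hb 1 one_pos 0)
  set μ := (volume : Measure ℝ).restrict (Ioo a b)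
  obtain ⟨w, hw, hvw⟩ := Metric.mem_closure_iff.1 hv (δ / (C * μ.real univ + 1)) (by positivity)
  refine ⟨_, hw a b, ?_⟩
  filter_upwards [self_mem_nhdsWithin] with ε hε
  rw [← integral_sub (integrable_inner_left (hb ε hε) (hc ε hε) (integrable_const v))
      (integrable_inner_left (hb ε hε) (hc ε hε) (integrable_const w))]
  simp only [← inner_sub_left]
  refine (norm_integral_inner_le (hb ε hε) _).trans ?_
  rw [dist_eq_norm, lt_div_iff₀ (by positivity)] at hvw
  nlinarith [norm_nonneg (v - w)]

/-- Density turns the null means over intervals into null means for every vector. A π-λ argument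
passes from intervals to measurable sets of times, and linearity with the uniform bound `C` passes
to simple functions and their `L¹` limits. -/
theorem tendsto_integral_inner_of_mean [CompleteSpace H] (s : ℝ → ℝ → H) {C : ℝ}
    (hb : ∀ ε > 0, ∀ t, ‖s ε t‖ ≤ C) (hc : ∀ ε > 0, Continuous (s ε))
    (hd : ∀ g : H, (∀ v ∈ meanNullSubmodule s hb hc, inner ℂ v g = 0) → g = 0)
    (T : ℝ) (g : ℝ → H) (hg : MemLp g 1 (volume.restrict (Ioo 0 T))) :
    Tendsto (fun ε => ∫ t in Ioo 0 T, inner ℂ (g t) (s ε t)) (𝓝[>] 0) (𝓝 0) := by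
  have hC : 0 ≤ C := (norm_nonneg _).trans (hb 1 one_pos 0)
  have htop : ∀ v, v ∈ meanNullSubmodule s hb hc := by
    have : CompleteSpace (meanNullSubmodule s hb hc) :=
      (isClosed_meanNullSubmodule s hb hc).completeSpace_coe
    have h : (meanNullSubmodule s hb hc)ᗮ = ⊥ := by
      rw [Submodule.eq_bot_iff]
      exact fun g hg => hd g fun v hv => (Submodule.mem_orthogonal _ _).1 hg v hv
    rw [Submodule.orthogonal_eq_bot_iff] at h
    simp [h]
  set μ := (volume : Measure ℝ).restrict (Ioo 0 T) with hμ
  have hset : ∀ (v : H) (A : Set ℝ), MeasurableSet A →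
      Tendsto (fun ε => ∫ t in A, inner ℂ v (s ε t) ∂μ) (𝓝[>] 0) (𝓝 0) := by
    intro v A hA
    have huniv : Tendsto (fun ε => ∫ t, inner ℂ v (s ε t) ∂μ) (𝓝[>] 0) (𝓝 0) := htop v 0 T
    -- Dynkin's theorem on the half-lines `Iio a`, whose traces on `(0, T)` are again intervals.
    refine MeasurableSpace.induction_on_inter (C := fun A _ =>
      Tendsto (fun ε => ∫ t in A, inner ℂ v (s ε t) ∂μ) (𝓝[>] 0) (𝓝 0))
      (BorelSpace.measurable_eq.trans (borel_eq_generateFrom_Iio ℝ)) isPiSystem_Iio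
      (by simp) ?_ ?_ ?_ A hA
    · rintro _ ⟨a, rfl⟩
      rw [hμ, Measure.restrict_restrict measurableSet_Iio]
      have : Iio a ∩ Ioo 0 T = Ioo 0 (min a T) := by
        ext x; simp only [mem_inter_iff, mem_Iio, mem_Ioo, lt_min_iff]; tauto
      rw [this]
      exact htop v _ _
    · intro B hB h
      have := huniv.sub h
      rw [sub_zero] at this
      refine this.congr' ?_
      filter_upwards [self_mem_nhdsWithin] with ε hε
      exact (setIntegral_compl hB
        (integrable_inner_left (hb ε hε) (hc ε hε) (integrable_const v))).symm
    · intro B hBd hB h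
      have hs : Summable fun i => μ.real (B i) :=
        ENNReal.summable_toReal (measure_ne_top_of_subset (Set.subset_univ _)
          (measure_ne_top μ univ) |> fun h' => by
            rw [← measure_iUnion hBd hB]; exact h')
      -- The `i`-th term is at most `‖v‖ C μ(B i)` uniformly in `ε`, which is summable because `μ`
      -- is finite.
      have := tendsto_tsum_of_dominated_convergence (𝓕 := 𝓝[>] (0 : ℝ))
        (f := fun ε i => ∫ t in B i, inner ℂ v (s ε t) ∂μ) (g := fun _ => (0 : ℂ))
        (hs.mul_left (‖v‖ * C)) h (by
          filter_upwards [self_mem_nhdsWithin] with ε hε i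
          refine (norm_integral_inner_le (hb ε hε) _).trans_eq ?_
          simp)
      rw [tsum_zero] at this
      refine this.congr' ?_
      filter_upwards [self_mem_nhdsWithin] with ε hε
      exact (integral_iUnion hB hBd
        (integrable_inner_left (hb ε hε) (hc ε hε) (integrable_const v)).integrableOn).symm
  have hint : ∀ {f : ℝ → H}, MemLp f 1 μ → ∀ ε > 0,
      Integrable (fun t => inner ℂ (f t) (s ε t)) μ := fun hf ε hε =>
    integrable_inner_left (hb ε hε) (hc ε hε) (memLp_one_iff_integrable.1 hf)
  refine MemLp.induction (p := 1) (by simp) (motive := fun g =>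
    Tendsto (fun ε => ∫ t, inner ℂ (g t) (s ε t) ∂μ) (𝓝[>] 0) (𝓝 0)) ?_ ?_ ?_ ?_ hg
  · intro v A hA _
    refine (hset v A hA).congr fun ε => ?_
    rw [← integral_indicator hA]
    refine integral_congr_ae (ae_of_all _ fun t => ?_)
    by_cases ht : t ∈ A <;> simp [ht]
  · intro f g _ hf hg h1 h2
    have := h1.add h2
    rw [add_zero] at this
    refine this.congr' ?_
    filter_upwards [self_mem_nhdsWithin] with ε hε
    simp only [Pi.add_apply, inner_add_left]
    exact (integral_add (hint hf ε hε) (hint hg ε hε)).symm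
  -- Replacing `f` by `w` changes the integral by at most `C ‖f - w‖₁`, uniformly in `ε`.
  · refine isClosed_of_closure_subset fun f hf => tendsto_zero_of_approx fun δ hδ => ?_
    obtain ⟨w, hw, hfw⟩ := Metric.mem_closure_iff.1 hf (δ / (C + 1)) (by positivity)
    refine ⟨_, hw, ?_⟩
    filter_upwards [self_mem_nhdsWithin] with ε hε
    rw [← integral_sub (hint (Lp.memLp f) ε hε) (hint (Lp.memLp w) ε hε)]
    simp only [← inner_sub_left]
    rw [dist_eq_norm, L1.norm_eq_integral_norm, lt_div_iff₀ (by positivity)] at hfw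
    have e1 : ∫ t, ‖f.1 t - w.1 t‖ ∂μ = ∫ t, ‖(f.1 - w.1) t‖ ∂μ := by
      refine integral_congr_ae ?_
      filter_upwards [AEEqFun.coeFn_sub f.1 w.1] with t ht
      rw [ht]; rfl
    have hi : Integrable (fun t => ‖f.1 t - w.1 t‖) μ :=
      ((memLp_one_iff_integrable.1 (Lp.memLp f)).sub (memLp_one_iff_integrable.1 (Lp.memLp w))).norm
    have e2 : ‖∫ t, inner ℂ (f.1 t - w.1 t) (s ε t) ∂μ‖ ≤ ∫ t, ‖f.1 t - w.1 t‖ * C ∂μ := by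
      refine norm_integral_le_of_norm_le (hi.mul_const C) (ae_of_all _ fun t => ?_)
      exact (norm_inner_le_norm _ _).trans (by gcongr; exact hb ε hε t)
    refine e2.trans ?_
    rw [integral_mul_const, e1]
    change (∫ t, ‖(f.1 - w.1) t‖ ∂μ) * (C + 1) < δ at hfw
    have : 0 ≤ ∫ t, ‖(f.1 - w.1) t‖ ∂μ := integral_nonneg fun t => norm_nonneg _
    nlinarith
  · intro f g hfg _ h
    refine h.congr fun ε => integral_congr_ae ?_
    filter_upwards [hfg] with t ht
    rw [ht]

end Criterion

/-! ### Time means of matrix elements of a unitary group -/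

section Group

variable {E : Type*} [NormedAddCommGroup E] [InnerProductSpace ℂ E] {A : E → E → Prop}
  {U : ℝ → E →L[ℂ] E}

lemma IsUnitaryGroup.inner_apply (hU : IsUnitaryGroup A U) (t : ℝ) (x y : E) :
    inner ℂ x (U t y) = inner ℂ (U (-t) x) y := by
  have h1 : U t (U (-t) x) = x := by
    change (U t * U (-t)) x = x
    rw [← hU.add, add_neg_cancel, hU.zero]; rfl
  let L : E →ₗᵢ[ℂ] E := ⟨(U t).toLinearMap, hU.norm_map t⟩
  conv_lhs => rw [← h1]
  exact L.inner_map_map _ _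

/-- Only `φ` is in the domain, `ψ` is arbitrary, so the group is moved onto `φ` before
differentiating: `⟨φ, U_t ψ⟩ = ⟨U_{-t} φ, ψ⟩`. -/
lemma IsUnitaryGroup.hasDerivAt_inner (hU : IsUnitaryGroup A U) {φ η : E} (h : A φ η) (ψ : E)
    (t : ℝ) : HasDerivAt (fun t => inner ℂ φ (U t ψ)) (-I * inner ℂ η (U t ψ)) t := by
  -- The generator is described at time `0` only; commuting with `U (-t)` transports that derivative
  -- to time `t`.
  have h1 : HasDerivAt (fun r => U (-r) (U (-t) φ)) (I • U (-t) η) 0 := by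
    have h0 := ((U (-t)).hasFDerivAt (x := U 0 φ)).restrictScalars ℝ |>.comp_hasDerivAt 0
      ((hU.generator φ η).1 h)
    have h2 := HasDerivAt.scomp (h := fun r : ℝ => -r) (0 : ℝ) (by simpa using h0) (hasDerivAt_neg 0)
    have e : ∀ r, U (-r) (U (-t) φ) = U (-t) (U (-r) φ) := fun r => by
      change (U (-r) * U (-t)) φ = (U (-t) * U (-r)) φ
      rw [← hU.add, ← hU.add, add_comm]
    simp only [e]
    simpa [Function.comp_def] using h2
  have h3 : HasDerivAt (fun r => inner ℂ (U (-r) (U (-t) φ)) ψ) (inner ℂ (I • U (-t) η) ψ) 0 := by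
    have := h1.inner ℂ (hasDerivAt_const (0 : ℝ) ψ)
    simpa only [inner_zero_right, zero_add] using this
  rw [inner_smul_left, conj_I, ← hU.inner_apply] at h3
  have h4 : HasDerivAt (fun r : ℝ => r - t) 1 t := (hasDerivAt_id t).sub_const t
  have h5 := HasDerivAt.scomp t (h := fun r : ℝ => r - t) (by simpa using h3) h4
  simp only [Function.comp_def, one_smul] at h5
  rw [neg_mul]
  refine h5.congr_of_eventuallyEq (Eventually.of_forall fun r => ?_)
  change _ = inner ℂ (U (-(r - t)) (U (-t) φ)) ψ
  have : U (-(r - t)) (U (-t) φ) = U (-r) φ := by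
    change (U (-(r - t)) * U (-t)) φ = _
    rw [← hU.add]; congr 2; ring
  rw [this]; exact hU.inner_apply r φ ψ

/-- Split `κ` into `η - λφ`, with `η` the value of the generator at `φ`, and a remainder. The first
part paired with the phase-shifted orbit is the derivative of `i⟨φ, ·⟩` along it, so only two
boundary values survive, each at most `‖φ‖ ‖ψ‖`. The remainder is estimated by the length of the
interval. -/
lemma IsUnitaryGroup.norm_integral_inner_le (hU : IsUnitaryGroup A U) {φ η : E} (h : A φ η) (ψ κ : E)
    (lam a b : ℝ) : ‖∫ t in Ioo a b, inner ℂ κ (Complex.exp (I * t * lam) • U t ψ)‖ ≤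
      (2 * ‖φ‖ + (volume.restrict (Ioo a b)).real univ * ‖κ - (η - (lam : ℂ) • φ)‖) * ‖ψ‖ := by
  set Ψ : ℝ → E := fun t => Complex.exp (I * t * lam) • U t ψ with hΨ
  have hexp : ∀ t : ℝ, ‖Complex.exp (I * t * lam)‖ = 1 := fun t => by
    rw [show I * t * lam = ((t * lam : ℝ) : ℂ) * I by push_cast; ring, norm_exp_ofReal_mul_I]
  have hn : ∀ t, ‖Ψ t‖ = ‖ψ‖ := fun t => by
    rw [hΨ]; simp only [norm_smul, hexp, one_mul, hU.norm_map]
  have hcont : Continuous Ψ := by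
    have := hU.continuous ψ
    simp only [hΨ]; fun_prop
  have hd : ∀ t, HasDerivAt (fun t => I * inner ℂ φ (Ψ t))
      (inner ℂ (η - (lam : ℂ) • φ) (Ψ t)) t := fun t => by
    have h1 : HasDerivAt (fun t : ℝ => Complex.exp (I * t * lam))
        (Complex.exp (I * t * lam) * (I * lam)) t := by
      have h0 : HasDerivAt (fun t : ℝ => I * (t : ℂ) * lam) (I * lam) t := by
        have := ((hasDerivAt_id t).ofReal_comp.const_mul I).mul_const (lam : ℂ)
        simpa using this
      exact h0.cexp
    have h2 := (h1.mul (hU.hasDerivAt_inner h ψ t)).const_mul I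
    simp only [hΨ, inner_smul_right]
    refine (h2.congr_deriv ?_).congr_of_eventuallyEq (Eventually.of_forall fun r => ?_)
    · rw [inner_sub_left, inner_smul_left, conj_ofReal]
      linear_combination (-Complex.exp (I * t * lam) * inner ℂ η (U t ψ)
        + Complex.exp (I * t * lam) * lam * inner ℂ φ (U t ψ)) * I_sq
    · rfl
  have hi : ∀ x : E, Integrable (fun t => inner ℂ x (Ψ t)) (volume.restrict (Ioo a b)) := fun x =>
    integrable_inner_left (fun t => (hn t).le) hcont (integrable_const x)
  have e : ∫ t in Ioo a b, inner ℂ κ (Ψ t) = (∫ t in Ioo a b, inner ℂ (η - (lam : ℂ) • φ) (Ψ t))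
      + ∫ t in Ioo a b, inner ℂ (κ - (η - (lam : ℂ) • φ)) (Ψ t) := by
    rw [← integral_add (hi _) (hi _)]
    simp only [← inner_add_left, add_sub_cancel]
  have b1 : ‖∫ t in Ioo a b, inner ℂ (η - (lam : ℂ) • φ) (Ψ t)‖ ≤ 2 * ‖φ‖ * ‖ψ‖ := by
    rcases le_or_gt b a with hab | hab
    · rw [Ioo_eq_empty (not_lt.2 hab)]; simp; positivity
    rw [← integral_Ioc_eq_integral_Ioo, ← intervalIntegral.integral_of_le hab.le,
      intervalIntegral.integral_eq_sub_of_hasDerivAt (fun t _ => hd t)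
        ((by fun_prop : Continuous fun t => inner ℂ (η - (lam : ℂ) • φ) (Ψ t)).intervalIntegrable _ _)]
    have b3 : ∀ t, ‖I * inner ℂ φ (Ψ t)‖ ≤ ‖φ‖ * ‖ψ‖ := fun t => by
      rw [norm_mul, norm_I, one_mul, ← hn t]; exact norm_inner_le_norm _ _
    linarith [norm_sub_le (I * inner ℂ φ (Ψ b)) (I * inner ℂ φ (Ψ a)), b3 a, b3 b]
  have b2 := _root_.norm_integral_inner_le (μ := volume.restrict (Ioo a b)) (fun t => (hn t).le)
    (κ - (η - (lam : ℂ) • φ))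
  rw [e]
  refine (norm_add_le _ _).trans ?_
  linarith

end Group

/-! ### Product states -/

lemma norm_toLp_sq {X : Type*} [MeasurableSpace X] {μ : Measure X} {k : X → ℂ} (hk : MemLp k 2 μ) :
    ‖hk.toLp‖ ^ 2 = ∫ x, ‖k x‖ ^ 2 ∂μ := by
  have h3 : ((‖hk.toLp‖ ^ 2 : ℝ) : ℂ) = ((∫ y, ‖k y‖ ^ 2 ∂μ : ℝ) : ℂ) := by
    rw [← integral_complex_ofReal]
    push_cast
    refine (Eq.symm (inner_self_eq_norm_sq_to_K (𝕜 := ℂ) hk.toLp)).trans ?_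
    rw [L2.inner_def]
    refine integral_congr_ae ?_
    filter_upwards [hk.coeFn_toLp] with y e1
    rw [e1]; exact inner_self_eq_norm_sq_to_K (𝕜 := ℂ) (k y)
  exact_mod_cast h3

/-- The product state `f(x) g(y)` in the frame with origin `p` and first axis along `d`. -/
noncomputable def productState (p d : Plane) (hd : ‖d‖ = 1) {f g : ℝ → ℂ} (hf : MemLp f 2 volume)
    (hg : MemLp g 2 volume) : L2Plane := (memLp_productState p d hd hf hg).toLp

/-- The frame is a measure-preserving measurable equivalence, so the formula holds with no
regularity assumed of `h`. -/
lemma integral_frameCoord (p d : Plane) (hd : ‖d‖ = 1) {F : Type*} [NormedAddCommGroup F]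
    [NormedSpace ℝ F] (h : Plane → F) :
    ∫ q, h q = ∫ z : ℝ × ℝ, h (framePoint p d z) := by
  have hc : Continuous (frameCoord p d) := by unfold frameCoord; fun_prop
  have hc' : Continuous (framePoint p d) := by unfold framePoint; fun_prop
  let e : (ℝ × ℝ) ≃ᵐ Plane :=
    { toFun := framePoint p d
      invFun := frameCoord p d
      left_inv := frameCoord_framePoint p d hd
      right_inv := framePoint_frameCoord p d hd
      measurable_toFun := hc'.measurable
      measurable_invFun := hc.measurable }
  exact ((measurePreserving_framePoint p d hd).integral_comp e.measurableEmbedding h).symm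

lemma norm_productState (p d : Plane) (hd : ‖d‖ = 1) {f g : ℝ → ℂ} (hf : MemLp f 2 volume)
    (hg : MemLp g 2 volume) : ‖productState p d hd hf hg‖ = ‖hf.toLp‖ * ‖hg.toLp‖ := by
  rw [← sq_eq_sq₀ (norm_nonneg _) (by positivity), mul_pow, productState, norm_toLp_sq,
    norm_toLp_sq, norm_toLp_sq, integral_frameCoord p d hd, ← integral_prod_mul]
  simp only [frameCoord_framePoint p d hd, norm_mul, mul_pow]
  rfl

lemma productState_congr (p d : Plane) (hd : ‖d‖ = 1) {f f' g : ℝ → ℂ} (hf : MemLp f 2 volume)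
    (hf' : MemLp f' 2 volume) (hg : MemLp g 2 volume) (h : f =ᵐ[volume] f') :
    productState p d hd hf hg = productState p d hd hf' hg := by
  refine MemLp.toLp_congr _ _ ?_
  have hq : Measure.QuasiMeasurePreserving (fun q : Plane => (frameCoord p d q).1) volume volume :=
    Measure.quasiMeasurePreserving_fst.comp (measurePreserving_frameCoord p d hd).quasiMeasurePreserving
  filter_upwards [hq.ae h] with q hq
  rw [hq]

/-- The map `v ↦ v(x) g(y)`. -/
noncomputable def tensorRight (p d : Plane) (hd : ‖d‖ = 1) {g : ℝ → ℂ} (hg : MemLp g 2 volume) :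
    L2Line →L[ℂ] L2Plane :=
  LinearMap.mkContinuous
    { toFun := fun v => productState p d hd (Lp.memLp v) hg
      map_add' := fun v w => by
        rw [productState_congr p d hd _ ((Lp.memLp v).add (Lp.memLp w)) hg (Lp.coeFn_add v w)]
        refine (MemLp.toLp_congr _ ((memLp_productState p d hd (Lp.memLp v) hg).add
          (memLp_productState p d hd (Lp.memLp w) hg)) (ae_of_all _ fun q => ?_)).trans
          (MemLp.toLp_add _ _)
        simp only [Pi.add_apply, add_mul]
      map_smul' := fun c v => by
        rw [productState_congr p d hd _ ((Lp.memLp v).const_smul c) hg (Lp.coeFn_smul c v)]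
        refine (MemLp.toLp_congr _ ((memLp_productState p d hd (Lp.memLp v) hg).const_smul c)
          (ae_of_all _ fun q => ?_)).trans (MemLp.toLp_const_smul _ _)
        simp only [Pi.smul_apply, smul_mul_assoc] }
    ‖hg.toLp‖ fun v => by
      change ‖productState p d hd (Lp.memLp v) hg‖ ≤ _
      rw [norm_productState, mul_comm, Lp.toLp_coeFn]

lemma tensorRight_toLp (p d : Plane) (hd : ‖d‖ = 1) {f g : ℝ → ℂ} (hf : MemLp f 2 volume)
    (hg : MemLp g 2 volume) : tensorRight p d hd hg hf.toLp = productState p d hd hf hg :=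
  productState_congr p d hd (Lp.memLp _) hf hg hf.coeFn_toLp

lemma norm_tensorRight_le (p d : Plane) (hd : ‖d‖ = 1) {g : ℝ → ℂ} (hg : MemLp g 2 volume) :
    ‖tensorRight p d hd hg‖ ≤ ‖hg.toLp‖ :=
  LinearMap.mkContinuous_norm_le _ (norm_nonneg _) _

/-- Fubini in the frame coordinates. Seeing the component as the adjoint of `v ↦ v(x) g(y)` gives
its norm bound and its continuity in time at once, and lets test vectors be moved to the plane. -/
theorem toLp_transverse (p d : Plane) (hd : ‖d‖ = 1) {g : ℝ → ℂ} (hg : MemLp g 2 volume)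
    (ψ : L2Plane) :
    (memLp_transverse p d hd hg ψ).toLp = (tensorRight p d hd hg).adjoint ψ := by
  refine ext_inner_left ℂ fun v => ?_
  rw [ContinuousLinearMap.adjoint_inner_right, L2.inner_def, L2.inner_def]
  have hi := L2.integrable_inner (𝕜 := ℂ) (tensorRight p d hd hg v) ψ
  have hi' := (measurePreserving_framePoint p d hd).integrable_comp_of_integrable hi
  rw [integral_frameCoord p d hd, Measure.volume_eq_prod, integral_prod]
  swap; · exact hi'
  have e1 : ∀ᵐ z : ℝ × ℝ, tensorRight p d hd hg v (framePoint p d z) = v z.1 * g z.2 := by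
    have h := (measurePreserving_framePoint p d hd).quasiMeasurePreserving.ae
      (memLp_productState p d hd (Lp.memLp v) hg).coeFn_toLp
    filter_upwards [h] with z hz
    refine hz.trans ?_
    rw [frameCoord_framePoint p d hd]
  rw [Measure.volume_eq_prod] at e1
  refine integral_congr_ae ?_
  filter_upwards [(memLp_transverse p d hd hg ψ).coeFn_toLp, Measure.ae_ae_of_ae_prod e1]
    with x h1 h2
  rw [h1, RCLike.inner_apply, ← integral_mul_const]
  refine integral_congr_ae ?_
  filter_upwards [h2] with y h3
  rw [h3, RCLike.inner_apply, map_mul]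
  ring

/-! ### Test functions in the domain of the Hamiltonian -/

section Test

variable {φ : Plane → ℂ}

lemma contDiff_partial (hφ : ContDiff ℝ ∞ φ) (v : Plane) :
    ContDiff ℝ ∞ fun q => fderiv ℝ φ q v :=
  (hφ.fderiv_right (m := ∞) (by simp)).clm_apply contDiff_const

lemma hasCompactSupport_partial (hc : HasCompactSupport φ) (v : Plane) :
    HasCompactSupport fun q => fderiv ℝ φ q v :=
  (hc.fderiv ℝ).comp_left (g := fun L : Plane →L[ℝ] ℂ => L v) rfl

lemma hasWeakPartial_of_test (hφ : ContDiff ℝ ∞ φ) (hc : HasCompactSupport φ) (i : Fin 2)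
    {ψ D : L2Plane} (hψ : ψ =ᵐ[volume] φ)
    (hD : D =ᵐ[volume] fun q => fderiv ℝ φ q (EuclideanSpace.single i 1)) :
    HasWeakPartial i ψ D := by
  intro χ hχ hχc
  have e1 : ∫ q, ψ q * fderiv ℝ χ q (EuclideanSpace.single i 1)
      = ∫ q, φ q * fderiv ℝ χ q (EuclideanSpace.single i 1) :=
    integral_congr_ae (by filter_upwards [hψ] with q h; rw [h])
  have e2 : ∫ q, D q * χ q = ∫ q, fderiv ℝ φ q (EuclideanSpace.single i 1) * χ q :=
    integral_congr_ae (by filter_upwards [hD] with q h; rw [h])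
  rw [e1, e2]
  refine integral_mul_fderiv_eq_neg_fderiv_mul_of_integrable ?_ ?_ ?_
    (fun x _ => hφ.differentiable (by simp) x) (fun x _ => hχ.differentiable (by simp) x)
  · exact ((contDiff_partial hφ _).continuous.mul
      hχ.continuous).integrable_of_hasCompactSupport hχc.mul_left
  · exact (hφ.continuous.mul
      (contDiff_partial hχ _).continuous).integrable_of_hasCompactSupport hc.mul_right
  · exact (hφ.continuous.mul hχ.continuous).integrable_of_hasCompactSupport hc.mul_right

lemma fderiv_conj_apply (hφ : ContDiff ℝ ∞ φ) (q v : Plane) :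
    fderiv ℝ (fun q => (starRingEnd ℂ) (φ q)) q v = (starRingEnd ℂ) (fderiv ℝ φ q v) := by
  have := conjCLE.toContinuousLinearMap.hasFDerivAt.comp q
    (hφ.differentiable (by simp) q).hasFDerivAt
  exact congrArg (fun L : Plane →L[ℝ] ℂ => L v) this.fderiv

/-- Weak derivatives are defined by the bilinear pairing and the inner product is sesquilinear, so
the definition is applied to the conjugate of `φ`. -/
lemma HasWeakPartial.inner_eq {i : Fin 2} {χ D : L2Plane} (h : HasWeakPartial i χ D)
    (hφ : ContDiff ℝ ∞ φ) (hc : HasCompactSupport φ) {a b : L2Plane} (ha : a =ᵐ[volume] φ)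
    (hb : b =ᵐ[volume] fun q => fderiv ℝ φ q (EuclideanSpace.single i 1)) :
    inner ℂ D a = -inner ℂ χ b := by
  have h1 := h (fun q => (starRingEnd ℂ) (φ q)) (conjCLE.contDiff.comp hφ)
    (hc.comp_left (by simp))
  have e1 : inner ℂ a D = ∫ q, D q * (starRingEnd ℂ) (φ q) := by
    rw [L2.inner_def]
    refine integral_congr_ae ?_
    filter_upwards [ha] with q hq
    rw [RCLike.inner_apply, hq]
  have e2 : inner ℂ b χ
      = ∫ q, χ q * fderiv ℝ (fun q => (starRingEnd ℂ) (φ q)) q (EuclideanSpace.single i 1) := by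
    rw [L2.inner_def]
    refine integral_congr_ae ?_
    filter_upwards [hb] with q hq
    rw [RCLike.inner_apply, hq, fderiv_conj_apply hφ]
  rw [← e1, ← e2] at h1
  rw [← inner_conj_symm, ← inner_conj_symm χ b, h1, map_neg, neg_neg]

/-- For an arbitrary form element `χ`, the form against a test function is integrated by parts: the
derivative on `χ` moves to `∂ᵢφ` by the definition of weak derivative, and a factor `d_Γ` moves
across pointwise. -/
theorem isHamiltonian_of_test (Γ : Set Plane) (ε : ℝ) (hφ : ContDiff ℝ ∞ φ)
    (hc : HasCompactSupport φ) {ψ η : L2Plane} (hψ : ψ =ᵐ[volume] φ)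
    (hη : η =ᵐ[volume] fun q => -(1 / 2) * ∑ i : Fin 2,
      fderiv ℝ (fun q => fderiv ℝ φ q (EuclideanSpace.single i 1)) q (EuclideanSpace.single i 1)
      + (1 / (2 * ε ^ 2) * Metric.infDist q Γ ^ 2 : ℝ) * φ q) :
    IsHamiltonian Γ ε ψ η := by
  have mem : ∀ g : Plane → ℂ, Continuous g → HasCompactSupport g → MemLp g 2 volume :=
    fun g h h' => h.memLp_of_hasCompactSupport h'
  have hΓ : Continuous fun q => (Metric.infDist q Γ : ℂ) :=
    continuous_ofReal.comp (Metric.continuous_infDist_pt Γ)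
  have hD := fun i : Fin 2 => mem _ (contDiff_partial hφ (EuclideanSpace.single i 1)).continuous
    (hasCompactSupport_partial hc _)
  have hDD := fun i : Fin 2 => mem _ (contDiff_partial (contDiff_partial hφ
    (EuclideanSpace.single i 1)) (EuclideanSpace.single i 1)).continuous
    (hasCompactSupport_partial (hasCompactSupport_partial hc _) _)
  have hw : MemLp (fun q => (Metric.infDist q Γ : ℂ) * φ q) 2 volume := mem _ (hΓ.mul hφ.continuous) hc.mul_left
  have hww : MemLp (fun q => (Metric.infDist q Γ : ℂ) * ((Metric.infDist q Γ : ℂ) * φ q)) 2 volume :=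
    mem _ (hΓ.mul (hΓ.mul hφ.continuous)) hc.mul_left.mul_left
  refine ⟨fun i => (hD i).toLp, hw.toLp, ⟨fun i => hasWeakPartial_of_test hφ hc i hψ
    (hD i).coeFn_toLp, ?_⟩, fun χ D' w' h => ?_⟩
  · filter_upwards [hψ, hw.coeFn_toLp] with q h1 h2
    rw [h2, h1]
  have e1 : ∀ i, inner ℂ (D' i) (hD i).toLp = -inner ℂ χ (hDD i).toLp := fun i =>
    (h.weak i).inner_eq (contDiff_partial hφ _) (hasCompactSupport_partial hc _)
      (hD i).coeFn_toLp (hDD i).coeFn_toLp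
  have e2 : inner ℂ w' hw.toLp = inner ℂ χ hww.toLp := by
    rw [L2.inner_def, L2.inner_def]
    refine integral_congr_ae ?_
    filter_upwards [h.dist, hw.coeFn_toLp, hww.coeFn_toLp] with q h1 h2 h3
    rw [h1, h2, h3]
    simp only [RCLike.inner_apply, map_mul, conj_ofReal]
    ring
  have e3 : η = (-(1 / 2) : ℂ) • ((hDD 0).toLp + (hDD 1).toLp)
      + (1 / (2 * (ε : ℂ) ^ 2)) • hww.toLp := by
    refine Lp.ext ?_
    filter_upwards [hη, Lp.coeFn_add ((-(1 / 2) : ℂ) • ((hDD 0).toLp + (hDD 1).toLp))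
      ((1 / (2 * (ε : ℂ) ^ 2)) • hww.toLp), Lp.coeFn_smul (-(1 / 2) : ℂ)
      ((hDD 0).toLp + (hDD 1).toLp), Lp.coeFn_add (hDD 0).toLp (hDD 1).toLp,
      Lp.coeFn_smul (1 / (2 * (ε : ℂ) ^ 2)) hww.toLp, (hDD 0).coeFn_toLp, (hDD 1).coeFn_toLp,
      hww.coeFn_toLp] with q h1 h2 h3 h4 h5 h6 h7 h8
    rw [h1, h2, Pi.add_apply, h3, h5, Pi.smul_apply, Pi.smul_apply, h4, Pi.add_apply, h6, h7, h8,
      Fin.sum_univ_two]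
    simp only [smul_eq_mul]
    push_cast
    ring
  rw [e2, Fin.sum_univ_two, e1, e1, e3]
  simp only [inner_add_right, inner_smul_right]
  ring

end Test

/-! ### The Laplacian of a product in frame coordinates -/

lemma hasFDerivAt_frameCoord (p d : Plane) (q : Plane) :
    HasFDerivAt (fun q => (frameCoord p d q).1) (innerSL ℝ d) q ∧
    HasFDerivAt (fun q => (frameCoord p d q).2) (innerSL ℝ (rot d)) q :=
  ⟨(innerSL ℝ d).hasFDerivAt.comp q (hasFDerivAt_sub_const p),
    (innerSL ℝ (rot d)).hasFDerivAt.comp q (hasFDerivAt_sub_const p)⟩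

lemma fderiv_product (p d : Plane) {a b a' b' : ℝ → ℂ} (ha : ∀ x, HasDerivAt a (a' x) x)
    (hb : ∀ y, HasDerivAt b (b' y) y) (q v : Plane) :
    fderiv ℝ (fun q => a (frameCoord p d q).1 * b (frameCoord p d q).2) q v
      = inner ℝ d v * (a' (frameCoord p d q).1 * b (frameCoord p d q).2)
        + inner ℝ (rot d) v * (a (frameCoord p d q).1 * b' (frameCoord p d q).2) := by
  obtain ⟨h1, h2⟩ := hasFDerivAt_frameCoord p d q
  have h := ((ha (frameCoord p d q).1).hasFDerivAt.comp q h1).mul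
    ((hb (frameCoord p d q).2).hasFDerivAt.comp q h2)
  have h' := congrArg (fun L : Plane →L[ℝ] ℂ => L v) h.fderiv
  refine h'.trans ?_
  simp
  ring

/-- Rotation invariance of the Laplacian: the directions `d` and `rot d` are orthonormal, so the
mixed terms `a' b'` cancel on summing over the Cartesian axes. -/
theorem sum_fderiv_fderiv_product (p d : Plane) (hd : ‖d‖ = 1) {a b a' b' a'' b'' : ℝ → ℂ}
    (ha : ∀ x, HasDerivAt a (a' x) x) (hb : ∀ y, HasDerivAt b (b' y) y)
    (ha' : ∀ x, HasDerivAt a' (a'' x) x) (hb' : ∀ y, HasDerivAt b' (b'' y) y) (q : Plane) :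
    ∑ i : Fin 2, fderiv ℝ (fun q => fderiv ℝ (fun q => a (frameCoord p d q).1 *
      b (frameCoord p d q).2) q (EuclideanSpace.single i 1)) q (EuclideanSpace.single i 1)
      = a'' (frameCoord p d q).1 * b (frameCoord p d q).2
        + a (frameCoord p d q).1 * b'' (frameCoord p d q).2 := by
  have hd1 : ((d 0 : ℝ) : ℂ) ^ 2 + ((d 1 : ℝ) : ℂ) ^ 2 = 1 := by
    have := EuclideanSpace.real_norm_sq_eq d
    rw [hd, Fin.sum_univ_two] at this
    have h : d 0 ^ 2 + d 1 ^ 2 = 1 := by simpa using this.symm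
    rw [← ofReal_pow, ← ofReal_pow, ← ofReal_add, h, ofReal_one]
  have diff : ∀ {a b a' b' : ℝ → ℂ}, (∀ x, HasDerivAt a (a' x) x) → (∀ y, HasDerivAt b (b' y) y) →
      DifferentiableAt ℝ (fun q => a (frameCoord p d q).1 * b (frameCoord p d q).2) q :=
    fun ha hb => by
      obtain ⟨h1, h2⟩ := hasFDerivAt_frameCoord p d q
      exact (((ha (frameCoord p d q).1).hasFDerivAt.comp q h1).mul
    ((hb (frameCoord p d q).2).hasFDerivAt.comp q h2)).differentiableAt
  have key : ∀ v : Plane, fderiv ℝ (fun q => fderiv ℝ (fun q => a (frameCoord p d q).1 *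
      b (frameCoord p d q).2) q v) q v
      = inner ℝ d v * (inner ℝ d v * (a'' (frameCoord p d q).1 * b (frameCoord p d q).2)
          + inner ℝ (rot d) v * (a' (frameCoord p d q).1 * b' (frameCoord p d q).2))
        + inner ℝ (rot d) v * (inner ℝ d v * (a' (frameCoord p d q).1 * b' (frameCoord p d q).2)
          + inner ℝ (rot d) v * (a (frameCoord p d q).1 * b'' (frameCoord p d q).2)) := fun v => by
    simp only [fderiv_product p d ha hb]
    rw [fderiv_fun_add ((diff ha' hb).const_mul _) ((diff ha hb').const_mul _),
      fderiv_const_mul (diff ha' hb), fderiv_const_mul (diff ha hb')]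
    simp only [add_apply, smul_apply, fderiv_product p d ha' hb, fderiv_product p d ha hb',
      smul_eq_mul]
  rw [Fin.sum_univ_two, key, key]
  have i1 : ∀ (e : Plane) (i : Fin 2), inner ℝ e (EuclideanSpace.single i (1 : ℝ)) = e i :=
    fun e i => by simp [EuclideanSpace.inner_single_right]
  simp only [i1]
  have r0 : rot d 0 = -d 1 := rfl
  have r1 : rot d 1 = d 0 := rfl
  rw [r0, r1]
  push_cast
  linear_combination (a'' (frameCoord p d q).1 * b (frameCoord p d q).2
        + a (frameCoord p d q).1 * b'' (frameCoord p d q).2) * hd1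

/-! ### Scaling of the transverse modes -/

/-- All modes of index `m` are dilations, by `√ε`, of one polynomial times a Gaussian; `(√√ε)⁻¹ =
ε^(-1/4)` keeps the `L²` norm fixed. This makes the later estimates uniform in `ε`. -/
lemma oscillatorState_scaling (m : ℕ) : ∃ Q : Polynomial ℝ, ∀ ε > 0, ∀ y,
    oscillatorState ε m y = (√√ε)⁻¹ * (Q.eval (y / √ε) * Real.exp (-(1 / 2) * (y / √ε) ^ 2)) := by
  refine ⟨Polynomial.C (√(m.factorial * √Real.pi))⁻¹ *
    ((Polynomial.hermite m).map (Int.castRingHom ℝ)).comp (Polynomial.C √2 * Polynomial.X),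
    fun ε hε y => ?_⟩
  have e1 : (((Polynomial.hermite m).map (Int.castRingHom ℝ)).comp
      (Polynomial.C √2 * Polynomial.X)).eval (y / √ε)
      = Polynomial.aeval (√(2 / ε) * y) (Polynomial.hermite m) := by
    rw [Polynomial.eval_comp, Polynomial.eval_map, Real.sqrt_div (by norm_num)]
    simp [Polynomial.aeval_def, div_mul_eq_mul_div, mul_div_assoc]
  rw [Polynomial.eval_mul, Polynomial.eval_C, e1, oscillatorState, Real.sqrt_mul Real.pi_pos.le,
    ← mul_assoc (m.factorial : ℝ), Real.sqrt_mul (by positivity), mul_inv, div_pow,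
    Real.sq_sqrt hε.le]
  have e2 : -y ^ 2 / (2 * ε) = -(1 / 2) * (y ^ 2 / ε) := by field_simp
  rw [e2]
  ring

lemma contDiff_oscillatorState (ε : ℝ) (m : ℕ) : ContDiff ℝ ∞ (oscillatorState ε m) := by
  have h : ContDiff ℝ ∞ fun y : ℝ => Polynomial.aeval (√(2 / ε) * y) (Polynomial.hermite m) :=
    (Polynomial.contDiff_aeval _ _).comp (contDiff_const.mul contDiff_id)
  unfold oscillatorState
  exact (contDiff_const.mul h).mul (((contDiff_id.pow 2).neg.div_const _).exp)

/-- The `L²` normalised dilation. -/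
noncomputable def dilate (s : ℝ) (G : ℝ → ℝ) (y : ℝ) : ℝ := (√s)⁻¹ * G (y / s)

lemma memLp_dilate {G : ℝ → ℝ} (hG : MemLp G 2 volume) {s : ℝ} (hs : 0 < s) :
    MemLp (fun y => (dilate s G y : ℂ)) 2 volume := by
  have hq : Measure.QuasiMeasurePreserving (fun y : ℝ => y / s) volume volume := by
    simp only [div_eq_mul_inv]
    have h := Measure.quasiMeasurePreserving_smul (volume : Measure ℝ) (inv_ne_zero hs.ne')
    simpa only [smul_eq_mul, mul_comm] using h
  have hm : AEStronglyMeasurable (dilate s G) volume :=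
    (hG.1.comp_quasiMeasurePreserving hq).const_mul _
  refine MemLp.ofReal ((memLp_two_iff_integrable_sq hm).2 ?_)
  have h := (((memLp_two_iff_integrable_sq hG.1).1 hG).comp_div hs.ne').const_mul (((√s)⁻¹) ^ 2)
  refine h.congr (ae_of_all _ fun y => ?_)
  simp only [dilate, mul_pow]

lemma norm_dilate {G : ℝ → ℝ} (hG : MemLp G 2 volume) {s : ℝ} (hs : 0 < s) :
    ‖(memLp_dilate hG hs).toLp‖ = ‖(hG.ofReal (K := ℂ)).toLp‖ := by
  rw [← sq_eq_sq₀ (norm_nonneg _) (norm_nonneg _), norm_toLp_sq, norm_toLp_sq]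
  simp only [dilate, ofReal_mul, norm_mul, mul_pow]
  rw [integral_const_mul]
  have := Measure.integral_comp_div (fun y => ‖(G y : ℂ)‖ ^ 2) s
  rw [this, smul_eq_mul, ← mul_assoc]
  have : ‖(((√s)⁻¹ : ℝ) : ℂ)‖ ^ 2 * |s| = 1 := by
    rw [norm_real, Real.norm_eq_abs, sq_abs, inv_pow, Real.sq_sqrt hs.le, abs_of_pos hs,
      inv_mul_cancel₀ hs.ne']
  rw [this, one_mul]
  rfl

/-- In the variable `z = y/√ε` the mode, `z` times the mode and its `z`-derivative are polynomials
times a Gaussian. Hence a single square integrable profile controls all three: a factor `|y|` gains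
`√ε`, and a `y`-derivative costs `1/√ε`. -/
lemma oscillatorState_bounds (m : ℕ) : ∃ G : ℝ → ℝ, MemLp G 2 volume ∧
    ∀ ε > 0, ∀ y, |oscillatorState ε m y| ≤ dilate √ε G y ∧
      |y| * |oscillatorState ε m y| ≤ √ε * dilate √ε G y ∧
      √ε * |deriv (oscillatorState ε m) y| ≤ dilate √ε G y := by
  obtain ⟨Q, hQ⟩ := oscillatorState_scaling m
  set w : ℝ → ℝ := fun z => Real.exp (-(1 / 2) * z ^ 2)
  -- The polynomial for which `(Q w)' = Q₁ w`, since `w' = -z w`.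
  set Q₁ := Polynomial.derivative Q - Polynomial.X * Q
  have mem : ∀ P : Polynomial ℝ, MemLp (fun z => |P.eval z * w z|) 2 volume := fun P =>
    (memLp_gaussian_poly P (show (0 : ℝ) < 1 / 2 by norm_num)).norm
  have hder : ∀ z, HasDerivAt (fun z => Q.eval z * w z) (Q₁.eval z * w z) z := fun z => by
    have h1 : HasDerivAt w (w z * (-(1 / 2) * (2 * z))) z := by
      have := ((hasDerivAt_pow 2 z).const_mul (-(1 / 2) : ℝ)).exp
      refine this.congr_deriv ?_
      simp [w]
    refine ((Q.hasDerivAt z).mul h1).congr_deriv ?_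
    simp only [Q₁, Polynomial.eval_sub, Polynomial.eval_mul, Polynomial.eval_X]
    ring
  refine ⟨fun z => |Q.eval z * w z| + |(Polynomial.X * Q).eval z * w z| + |Q₁.eval z * w z|,
    ((mem _).add (mem _)).add (mem _), fun ε hε y => ?_⟩
  have hs : 0 < √ε := Real.sqrt_pos.2 hε
  have hs' : 0 < √√ε := Real.sqrt_pos.2 hs
  have a1 := abs_nonneg (Q.eval (y / √ε) * w (y / √ε))
  have a2 := abs_nonneg ((Polynomial.X * Q).eval (y / √ε) * w (y / √ε))
  have a3 := abs_nonneg (Q₁.eval (y / √ε) * w (y / √ε))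
  have i1 : 0 < (√√ε)⁻¹ := inv_pos.2 hs'
  refine ⟨?_, ?_, ?_⟩
  · rw [hQ ε hε, abs_mul, abs_of_pos i1, dilate]
    gcongr
    linarith
  · have : |y| * |oscillatorState ε m y|
        = √ε * ((√√ε)⁻¹ * |(Polynomial.X * Q).eval (y / √ε) * w (y / √ε)|) := by
      rw [hQ ε hε, abs_mul, abs_of_pos i1, Polynomial.eval_mul, Polynomial.eval_X, mul_assoc,
        abs_mul (y / √ε), abs_div, abs_of_pos hs]
      change _ * (_ * |Polynomial.eval (y / √ε) Q * w (y / √ε)|) = _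
      generalize w (y / √ε) = w'
      field_simp
    rw [this, dilate]
    gcongr
    linarith
  · have : deriv (oscillatorState ε m) y = (√√ε)⁻¹ * (Q₁.eval (y / √ε) * w (y / √ε) * (1 / √ε)) := by
      have h := ((hder (y / √ε)).comp y ((hasDerivAt_id y).div_const √ε)).const_mul (√√ε)⁻¹
      exact (h.congr_of_eventuallyEq (Eventually.of_forall fun y => hQ ε hε y)).deriv
    rw [this, abs_mul, abs_of_pos i1, abs_mul _ (1 / √ε), abs_of_pos (one_div_pos.2 hs), dilate]
    have : √ε * ((√√ε)⁻¹ * (|Q₁.eval (y / √ε) * w (y / √ε)| * (1 / √ε)))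
        = (√√ε)⁻¹ * |Q₁.eval (y / √ε) * w (y / √ε)| := by field_simp
    rw [this]
    gcongr
    linarith

/-- The exact value of the norm plays no role below; a bound uniform in `ε` is enough. -/
lemma exists_norm_oscillatorState_le (m : ℕ) :
    ∃ C, ∀ ε > 0, ‖(memLp_oscillatorState ε m).toLp‖ ≤ C := by
  obtain ⟨G, hG, h⟩ := oscillatorState_bounds m
  refine ⟨‖(hG.ofReal (K := ℂ)).toLp‖, fun ε hε => ?_⟩
  rw [← norm_dilate hG (Real.sqrt_pos.2 hε)]
  refine Lp.norm_le_norm_of_ae_le ?_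
  filter_upwards [(memLp_oscillatorState ε m).coeFn_toLp,
    (memLp_dilate hG (Real.sqrt_pos.2 hε)).coeFn_toLp] with y h1 h2
  rw [h1, h2, norm_real, norm_real, Real.norm_eq_abs, Real.norm_eq_abs]
  exact ((h ε hε y).1).trans (le_abs_self _)

lemma norm_le_of_product_bound (p d : Plane) (hd : ‖d‖ = 1) {f g : ℝ → ℝ}
    (hf : MemLp (fun x => (f x : ℂ)) 2 volume) (hg : MemLp (fun x => (g x : ℂ)) 2 volume)
    {κ : L2Plane} (h : ∀ᵐ q, ‖κ q‖ ≤ f (frameCoord p d q).1 * g (frameCoord p d q).2) :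
    ‖κ‖ ≤ ‖hf.toLp‖ * ‖hg.toLp‖ := by
  rw [← norm_productState p d hd hf hg]
  refine Lp.norm_le_norm_of_ae_le ?_
  filter_upwards [h, (memLp_productState p d hd hf hg).coeFn_toLp] with q h1 h2
  rw [productState, h2, ← ofReal_mul, norm_real]
  exact h1.trans (le_abs_self _)

/-! ### Test functions concentrated near a line -/

lemma hasCompactSupport_productState (p d : Plane) (hd : ‖d‖ = 1) {a b : ℝ → ℂ}
    (ha : HasCompactSupport a) (hb : HasCompactSupport b) :
    HasCompactSupport fun q => a (frameCoord p d q).1 * b (frameCoord p d q).2 := by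
  have hc : Continuous (framePoint p d) := by unfold framePoint; fun_prop
  refine HasCompactSupport.intro (ha.isCompact.prod hb.isCompact |>.image hc) fun q hq => ?_
  by_contra h
  rw [mul_eq_zero, not_or] at h
  exact hq ⟨frameCoord p d q, ⟨subset_tsupport _ h.1, subset_tsupport _ h.2⟩,
    framePoint_frameCoord p d hd q⟩

lemma memLp_hamiltonian_test (Γ : Set Plane) (ε : ℝ) {φ : Plane → ℂ} (hφ : ContDiff ℝ ∞ φ)
    (hc : HasCompactSupport φ) :
    MemLp (fun q => -(1 / 2) * ∑ i : Fin 2,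
      fderiv ℝ (fun q => fderiv ℝ φ q (EuclideanSpace.single i 1)) q (EuclideanSpace.single i 1)
      + (1 / (2 * ε ^ 2) * Metric.infDist q Γ ^ 2 : ℝ) * φ q) 2 volume := by
  have h : ∀ i : Fin 2, MemLp (fun q => fderiv ℝ (fun q => fderiv ℝ φ q
      (EuclideanSpace.single i 1)) q (EuclideanSpace.single i 1)) 2 volume := fun i =>
    (contDiff_partial (contDiff_partial hφ _) _).continuous.memLp_of_hasCompactSupport
      (hasCompactSupport_partial (hasCompactSupport_partial hc _) _)
  have h1 := (memLp_finsetSum Finset.univ fun i _ => h i).const_mul (-(1 / 2) : ℂ)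
  have h2 : MemLp (fun q => ((1 / (2 * ε ^ 2) * Metric.infDist q Γ ^ 2 : ℝ) : ℂ) * φ q) 2 volume :=
    Continuous.memLp_of_hasCompactSupport
      ((continuous_ofReal.comp (((Metric.continuous_infDist_pt Γ).pow 2).const_mul _)).mul
        hφ.continuous) hc.mul_left
  exact h1.add h2

/-- The pointwise form of the main estimate. The letters `u0, u2`, `θ0, θ1, θ2`, `Φ0, Φ1, Φ2` stand
for values of the functions and of their derivatives of that order, `D` for the distance to `Γ`, `X`
for the dilated profile. The oscillator equation eliminates `Φ2` and leaves `½ c u''θΦ + c u (θ'Φ' +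
½ θ''Φ) - ZΦ`, with `Z` the multiplier defect. Since `c = O(ε)`, even the term with `Φ'` is `O(√ε)`;
the defect is `O(|y| + ε)`, and `|y|` against `Φ` is again `O(√ε)`. -/
lemma norm_remainder_le {ε B K D X u0 u2 v0 k0 θ0 θ1 θ2 Φ0 Φ1 Φ2 c y : ℝ} {m n : ℕ}
    (hε : 0 < ε) (hε1 : ε ≤ 1)
    (hode : -(1 / 2) * Φ2 + 1 / (2 * ε ^ 2) * y ^ 2 * Φ0 = (m + 1 / 2) / ε * Φ0) (hkq : 0 ≤ k0)
    (hB : 0 ≤ B) (hK : 0 ≤ K) (cc : |c| ≤ K * ε) (c0 : |θ0| ≤ B) (c1 : |θ1| ≤ B) (c2 : |θ2| ≤ B)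
    (g1 : |Φ0| ≤ X) (g2 : |y| * |Φ0| ≤ √ε * X) (g3 : √ε * |Φ1| ≤ X)
    (hq : |c * (((m : ℝ) - n) / ε + (D ^ 2 - y ^ 2) / (2 * ε ^ 2)) * θ0 * u0 - v0|
      ≤ k0 * (|y| + ε)) :
    ‖(v0 : ℂ) * Φ0 - (-(1 / 2) * (((c * u2 : ℝ) : ℂ) * ((θ0 * Φ0 : ℝ) : ℂ)
        + ((c * u0 : ℝ) : ℂ) * ((θ2 * Φ0 + θ1 * Φ1 + (θ1 * Φ1 + θ0 * Φ2) : ℝ) : ℂ))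
        + ((1 / (2 * ε ^ 2) * D ^ 2 : ℝ) : ℂ) * (((c * u0 : ℝ) : ℂ) * ((θ0 * Φ0 : ℝ) : ℂ))
        - (((n + 1 / 2) / ε : ℝ) : ℂ) • (((c * u0 : ℝ) : ℂ) * ((θ0 * Φ0 : ℝ) : ℂ)))‖
      ≤ (K * B * (|u2| + 2 * |u0|) + 2 * k0) * (√ε * X) := by
  have hs1 : √ε ≤ 1 := Real.sqrt_le_one.2 hε1
  have hs2 : √ε * √ε = ε := Real.mul_self_sqrt hε.le
  have hs3 : 0 ≤ √ε := Real.sqrt_nonneg ε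
  have hX : 0 ≤ X := (abs_nonneg _).trans g1
  generalize √ε = s at *
  set Z := c * (((m : ℝ) - n) / ε + (D ^ 2 - y ^ 2) / (2 * ε ^ 2)) * θ0 * u0 - v0 with hZ
  have eq : (v0 : ℂ) * Φ0 - (-(1 / 2) * (((c * u2 : ℝ) : ℂ) * ((θ0 * Φ0 : ℝ) : ℂ)
      + ((c * u0 : ℝ) : ℂ) * ((θ2 * Φ0 + θ1 * Φ1 + (θ1 * Φ1 + θ0 * Φ2) : ℝ) : ℂ))
      + ((1 / (2 * ε ^ 2) * D ^ 2 : ℝ) : ℂ) * (((c * u0 : ℝ) : ℂ) * ((θ0 * Φ0 : ℝ) : ℂ))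
      - (((n + 1 / 2) / ε : ℝ) : ℂ) • (((c * u0 : ℝ) : ℂ) * ((θ0 * Φ0 : ℝ) : ℂ)))
      = ((1 / 2 * c * u2 * θ0 * Φ0 + (c * u0 * (θ1 * Φ1) + c * u0 * (1 / 2 * θ2 * Φ0))
        - Z * Φ0 : ℝ) : ℂ) := by
    have hreal : v0 * Φ0 - (-(1 / 2) * ((c * u2) * (θ0 * Φ0)
        + (c * u0) * (θ2 * Φ0 + θ1 * Φ1 + (θ1 * Φ1 + θ0 * Φ2)))
        + (1 / (2 * ε ^ 2) * D ^ 2) * ((c * u0) * (θ0 * Φ0))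
        - ((n + 1 / 2) / ε) * ((c * u0) * (θ0 * Φ0)))
        = 1 / 2 * c * u2 * θ0 * Φ0 + (c * u0 * (θ1 * Φ1) + c * u0 * (1 / 2 * θ2 * Φ0)) - Z * Φ0 := by
      rw [hZ]
      field_simp at hode ⊢
      linear_combination (-c * u0 * θ0) * hode
    rw [← hreal, smul_eq_mul]
    push_cast
    ring
  rw [eq, norm_real, Real.norm_eq_abs]
  clear eq hode
  have l1 : |c| * |Φ0| ≤ K * (s * X) := by
    calc |c| * |Φ0| ≤ (K * ε) * X := by gcongr
      _ = K * (s * X) * s := by rw [← hs2]; ring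
      _ ≤ K * (s * X) * 1 := by gcongr
      _ = _ := mul_one _
  have l2 : |c| * |Φ1| ≤ K * (s * X) := by
    calc |c| * |Φ1| ≤ (K * ε) * |Φ1| := by gcongr
      _ = K * (s * (s * |Φ1|)) := by rw [← hs2]; ring
      _ ≤ _ := by gcongr
  have l3 : |Z| * |Φ0| ≤ k0 * 2 * (s * X) := by
    calc |Z| * |Φ0| ≤ k0 * (|y| + ε) * |Φ0| := by gcongr
      _ = k0 * (|y| * |Φ0| + s * (s * |Φ0|)) := by rw [← hs2]; ring
      _ ≤ k0 * (s * X + s * (1 * X)) := by gcongr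
      _ = _ := by ring
  have t1 : |1 / 2 * c * u2 * θ0 * Φ0| ≤ K * B * |u2| * (s * X) := by
    simp only [abs_mul]
    rw [abs_of_pos (by norm_num : (0 : ℝ) < 1 / 2)]
    calc 1 / 2 * |c| * |u2| * |θ0| * |Φ0| = 1 / 2 * (|u2| * |θ0| * (|c| * |Φ0|)) := by ring
      _ ≤ 1 * (|u2| * B * (K * (s * X))) := by gcongr; norm_num
      _ = _ := by ring
  have t2 : |c * u0 * (θ1 * Φ1)| ≤ K * B * |u0| * (s * X) := by
    simp only [abs_mul]
    calc |c| * |u0| * (|θ1| * |Φ1|) = |u0| * |θ1| * (|c| * |Φ1|) := by ring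
      _ ≤ |u0| * B * (K * (s * X)) := by gcongr
      _ = _ := by ring
  have t3 : |c * u0 * (1 / 2 * θ2 * Φ0)| ≤ K * B * |u0| * (s * X) := by
    simp only [abs_mul]
    rw [abs_of_pos (by norm_num : (0 : ℝ) < 1 / 2)]
    calc |c| * |u0| * (1 / 2 * |θ2| * |Φ0|) = 1 / 2 * (|u0| * |θ2| * (|c| * |Φ0|)) := by ring
      _ ≤ 1 * (|u0| * B * (K * (s * X))) := by gcongr; norm_num
      _ = _ := by ring
  rw [← abs_mul] at l3
  have tri := norm_sub_le (1 / 2 * c * u2 * θ0 * Φ0 + (c * u0 * (θ1 * Φ1)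
    + c * u0 * (1 / 2 * θ2 * Φ0))) (Z * Φ0)
  have tri2 := norm_add_le (1 / 2 * c * u2 * θ0 * Φ0) (c * u0 * (θ1 * Φ1)
    + c * u0 * (1 / 2 * θ2 * Φ0))
  have tri3 := norm_add_le (c * u0 * (θ1 * Φ1)) (c * u0 * (1 / 2 * θ2 * Φ0))
  simp only [Real.norm_eq_abs] at tri tri2 tri3
  linarith

/-- If `v(x)` is, up to an error controlled by `|y| + ε`, the multiplier with which
`H(ε) - E_n/ε` acts on `c_ε u(x) θ(y) Φ_m^ε(y)`, then `v(x) Φ_m^ε(y)` is approximately in the range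
of `H(ε) - E_n/ε` on states tending to zero. -/
theorem exists_approx_preimage (Γ : Set Plane) (p d : Plane) (hd : ‖d‖ = 1) (m n : ℕ)
    {u θ : ℝ → ℝ} (hu : ContDiff ℝ ∞ u) (huc : HasCompactSupport u) (hθ : ContDiff ℝ ∞ θ)
    (hθc : HasCompactSupport θ) {v k c : ℝ → ℝ} (hv : MemLp (fun x => (v x : ℂ)) 2 volume)
    (hk : MemLp (fun x => (k x : ℂ)) 2 volume) {K : ℝ}
    (hc : ∀ ε > 0, ε ≤ 1 → |c ε| ≤ K * ε)
    (h : ∀ ε > 0, ε ≤ 1 → ∀ q, |c ε * (((m : ℝ) - n) / ε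
        + (Metric.infDist q Γ ^ 2 - (frameCoord p d q).2 ^ 2) / (2 * ε ^ 2))
        * θ (frameCoord p d q).2 * u (frameCoord p d q).1 - v (frameCoord p d q).1|
        ≤ k (frameCoord p d q).1 * (|(frameCoord p d q).2| + ε)) :
    ∃ φ η : ℝ → L2Plane, (∀ ε > 0, IsHamiltonian Γ ε (φ ε) (η ε)) ∧
      Tendsto (fun ε => ‖φ ε‖) (𝓝[>] 0) (𝓝 0) ∧
      Tendsto (fun ε => ‖tensorRight p d hd (memLp_oscillatorState ε m) hv.toLp
        - (η ε - (((n + 1 / 2) / ε : ℝ) : ℂ) • φ ε)‖) (𝓝[>] 0) (𝓝 0) := by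
  obtain ⟨G, hG, hb⟩ := oscillatorState_bounds m
  have hu' : ContDiff ℝ ∞ (deriv u) := (contDiff_infty_iff_deriv.1 hu).2
  have hu'' : ContDiff ℝ ∞ (deriv (deriv u)) := (contDiff_infty_iff_deriv.1 hu').2
  have hθ' : ContDiff ℝ ∞ (deriv θ) := (contDiff_infty_iff_deriv.1 hθ).2
  have hθ'' : ContDiff ℝ ∞ (deriv (deriv θ)) := (contDiff_infty_iff_deriv.1 hθ').2
  have dr : ∀ {g : ℝ → ℝ}, ContDiff ℝ ∞ g → ∀ x, HasDerivAt g (deriv g x) x := fun hg x =>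
    (hg.differentiable (by simp) x).hasDerivAt
  obtain ⟨B, hB, b0, b1, b2⟩ : ∃ B, 0 ≤ B ∧ (∀ y, |θ y| ≤ B) ∧ (∀ y, |deriv θ y| ≤ B) ∧
      ∀ y, |deriv (deriv θ) y| ≤ B := by
    obtain ⟨B₀, h0⟩ := hθ.continuous.bounded_above_of_compact_support hθc
    obtain ⟨B₁, h1⟩ := hθ'.continuous.bounded_above_of_compact_support hθc.deriv
    obtain ⟨B₂, h2⟩ := hθ''.continuous.bounded_above_of_compact_support hθc.deriv.deriv
    have p0 := (norm_nonneg _).trans (h0 0)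
    have p1 := (norm_nonneg _).trans (h1 0)
    have p2 := (norm_nonneg _).trans (h2 0)
    exact ⟨B₀ + B₁ + B₂, by linarith, fun y => (h0 y).trans (by linarith),
      fun y => (h1 y).trans (by linarith), fun y => (h2 y).trans (by linarith)⟩
  have hK : 0 ≤ K := by have := (abs_nonneg _).trans (hc 1 one_pos le_rfl); linarith
  -- The longitudinal factor produced by `norm_remainder_le`; it also dominates the one needed for
  -- `φ_ε` itself.
  set ku : ℝ → ℝ := fun x => K * B * (|deriv (deriv u) x| + 2 * |u x|) + 2 * k x with hku
  have memu : MemLp (fun x => (ku x : ℂ)) 2 volume := by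
    have m1 : MemLp u 2 volume := hu.continuous.memLp_of_hasCompactSupport huc
    have m2 : MemLp (deriv (deriv u)) 2 volume :=
      hu''.continuous.memLp_of_hasCompactSupport huc.deriv.deriv
    have m3 : MemLp k 2 volume := by simpa using hk.re
    exact (((m2.norm.add (m1.norm.const_mul 2)).const_mul (K * B)).add (m3.const_mul 2)).ofReal
  set R := ‖memu.toLp‖ * ‖(hG.ofReal (K := ℂ)).toLp‖
  have hosc : ∀ ε, ContDiff ℝ ∞ (oscillatorState ε m) := fun ε => contDiff_oscillatorState ε m
  set a : ℝ → ℝ → ℂ := fun ε x => ((c ε * u x : ℝ) : ℂ) with ha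
  set b : ℝ → ℝ → ℂ := fun ε y => ((θ y * oscillatorState ε m y : ℝ) : ℂ) with hbdef
  set φ₀ : ℝ → Plane → ℂ := fun ε q => a ε (frameCoord p d q).1 * b ε (frameCoord p d q).2 with hφ₀
  have cda : ∀ ε, ContDiff ℝ ∞ (a ε) := fun ε => ofRealCLM.contDiff.comp (contDiff_const.mul hu)
  have cdb : ∀ ε, ContDiff ℝ ∞ (b ε) := fun ε => ofRealCLM.contDiff.comp (hθ.mul (hosc ε))
  have csa : ∀ ε, HasCompactSupport (a ε) := fun ε =>
    (huc.mul_left (f := fun _ => c ε)).comp_left ofReal_zero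
  have csb : ∀ ε, HasCompactSupport (b ε) := fun ε =>
    (hθc.mul_right (f' := oscillatorState ε m)).comp_left ofReal_zero
  have cdφ : ∀ ε, ContDiff ℝ ∞ (φ₀ ε) := fun ε => by
    have f1 : ContDiff ℝ ∞ fun q : Plane => (frameCoord p d q).1 := by
      exact (innerSL ℝ d).contDiff.comp (contDiff_id.sub contDiff_const)
    have f2 : ContDiff ℝ ∞ fun q : Plane => (frameCoord p d q).2 := by
      exact (innerSL ℝ (rot d)).contDiff.comp (contDiff_id.sub contDiff_const)
    exact ((cda ε).comp f1).mul ((cdb ε).comp f2)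
  have csφ : ∀ ε, HasCompactSupport (φ₀ ε) := fun ε =>
    hasCompactSupport_productState p d hd (csa ε) (csb ε)
  set η₀ : ℝ → Plane → ℂ := fun ε q => -(1 / 2) * ∑ i : Fin 2,
      fderiv ℝ (fun q => fderiv ℝ (φ₀ ε) q (EuclideanSpace.single i 1)) q (EuclideanSpace.single i 1)
      + (1 / (2 * ε ^ 2) * Metric.infDist q Γ ^ 2 : ℝ) * φ₀ ε q with hη₀
  have memφ : ∀ ε, MemLp (φ₀ ε) 2 volume := fun ε =>
    (cdφ ε).continuous.memLp_of_hasCompactSupport (csφ ε)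
  have memη : ∀ ε, MemLp (η₀ ε) 2 volume := fun ε => memLp_hamiltonian_test Γ ε (cdφ ε) (csφ ε)
  -- A pointwise bound by `ku(x)` times `√ε` times the dilated profile gives `‖κ ε‖ ≤ √ε R`, because
  -- dilation preserves the `L²` norm.
  have small : ∀ κ : ℝ → L2Plane, (∀ ε > 0, ε ≤ 1 → ∀ᵐ q, ‖κ ε q‖ ≤ ku (frameCoord p d q).1 *
      (√ε * dilate √ε G (frameCoord p d q).2)) → Tendsto (fun ε => ‖κ ε‖) (𝓝[>] 0) (𝓝 0) := by
    intro κ hκ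
    have t0 : Tendsto (fun ε => √ε * R) (𝓝[>] (0 : ℝ)) (𝓝 0) := by
      have h0 : Tendsto (fun ε : ℝ => √ε * R) (𝓝 0) (𝓝 (√0 * R)) :=
        (Real.continuous_sqrt.tendsto 0).mul_const R
      rw [Real.sqrt_zero, zero_mul] at h0
      exact h0.mono_left nhdsWithin_le_nhds
    refine squeeze_zero' (Eventually.of_forall fun _ => norm_nonneg _) ?_ t0
    have hev : ∀ᶠ ε in 𝓝[>] (0 : ℝ), ε ≤ 1 :=
      nhdsWithin_le_nhds (eventually_le_nhds (zero_lt_one' ℝ))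
    filter_upwards [self_mem_nhdsWithin, hev] with ε hε hε1
    have hs : 0 < √ε := Real.sqrt_pos.2 hε
    have key := norm_le_of_product_bound p d hd (κ := ((√ε)⁻¹ : ℂ) • κ ε) memu (memLp_dilate hG hs) (by
      filter_upwards [hκ ε hε hε1, Lp.coeFn_smul ((√ε)⁻¹ : ℂ) (κ ε)] with q h1 h2
      rw [h2, Pi.smul_apply, norm_smul, norm_inv, norm_real, Real.norm_of_nonneg hs.le,
        inv_mul_le_iff₀ hs]
      linarith)
    rw [norm_dilate hG hs, norm_smul, norm_inv, norm_real, Real.norm_of_nonneg hs.le,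
      inv_mul_le_iff₀ hs] at key
    exact key
  -- The hypothesis `h` at `ε = 1` already forces `k` to be nonnegative.
  have kpos : ∀ q, 0 ≤ k (frameCoord p d q).1 := fun q => by
    have h1 := (abs_nonneg _).trans (h 1 one_pos le_rfl q)
    have h2 : 0 < |(frameCoord p d q).2| + 1 := by positivity
    exact nonneg_of_mul_nonneg_left h1 h2
  refine ⟨fun ε => (memφ ε).toLp, fun ε => (memη ε).toLp, fun ε hε =>
    isHamiltonian_of_test Γ ε (cdφ ε) (csφ ε) (memφ ε).coeFn_toLp (memη ε).coeFn_toLp,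
    small _ fun ε hε hε1 => ?_, small _ fun ε hε hε1 => ?_⟩
  · filter_upwards [(memφ ε).coeFn_toLp] with q hq
    rw [hq, hφ₀]
    simp only [ha, hbdef]
    rw [← ofReal_mul, norm_real, Real.norm_eq_abs, abs_mul, abs_mul, abs_mul]
    obtain ⟨g1, g2, g3⟩ := hb ε hε (frameCoord p d q).2
    have hkq := kpos q
    generalize (frameCoord p d q).1 = x at *
    generalize (frameCoord p d q).2 = y at *
    have hs1 : √ε ≤ 1 := Real.sqrt_le_one.2 hε1
    have hs2 : ε ≤ √ε := by
      nlinarith [Real.sq_sqrt hε.le, Real.sqrt_nonneg ε]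
    have hD : 0 ≤ dilate √ε G y := (abs_nonneg _).trans g1
    calc |c ε| * |u x| * (|θ y| * |oscillatorState ε m y|)
        ≤ (K * √ε) * |u x| * (B * dilate √ε G y) := by
          gcongr
          · exact (hc ε hε hε1).trans (by gcongr)
          · exact b0 y
      _ = (K * B * |u x|) * (√ε * dilate √ε G y) := by ring
      _ ≤ _ := by
          gcongr
          have : 0 ≤ K * B * (|deriv (deriv u) x| + |u x|) := by positivity
          simp only [hku]
          linarith
  · have ev1 := (memφ ε).coeFn_toLp
    have ev2 := (memη ε).coeFn_toLp
    have ev3 := (memLp_productState p d hd hv (memLp_oscillatorState ε m)).coeFn_toLp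
    rw [tensorRight_toLp, productState]
    filter_upwards [ev1, ev2, ev3, Lp.coeFn_sub
      (memLp_productState p d hd hv (memLp_oscillatorState ε m)).toLp
      ((memη ε).toLp - (((n + 1 / 2) / ε : ℝ) : ℂ) • (memφ ε).toLp), Lp.coeFn_sub (memη ε).toLp
      ((((n + 1 / 2) / ε : ℝ) : ℂ) • (memφ ε).toLp), Lp.coeFn_smul (((n + 1 / 2) / ε : ℝ) : ℂ)
      (memφ ε).toLp] with q h1 h2 h3 h4 h5 h6
    rw [h4, Pi.sub_apply, h5, Pi.sub_apply, h6, Pi.smul_apply, h1, h2, h3]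
    have da : ∀ x, HasDerivAt (a ε) ((c ε * deriv u x : ℝ) : ℂ) x := fun x =>
      ((dr hu x).const_mul (c ε)).ofReal_comp
    have da' : ∀ x, HasDerivAt (fun x => ((c ε * deriv u x : ℝ) : ℂ))
        ((c ε * deriv (deriv u) x : ℝ) : ℂ) x := fun x =>
      ((dr hu' x).const_mul (c ε)).ofReal_comp
    have hosc' : ContDiff ℝ ∞ (deriv (oscillatorState ε m)) := (contDiff_infty_iff_deriv.1 (hosc ε)).2
    have db : ∀ y, HasDerivAt (b ε) ((deriv θ y * oscillatorState ε m y
        + θ y * deriv (oscillatorState ε m) y : ℝ) : ℂ) y := fun y =>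
      ((dr hθ y).mul (dr (hosc ε) y)).ofReal_comp
    have db' : ∀ y, HasDerivAt (fun y => ((deriv θ y * oscillatorState ε m y
        + θ y * deriv (oscillatorState ε m) y : ℝ) : ℂ))
        ((deriv (deriv θ) y * oscillatorState ε m y + deriv θ y * deriv (oscillatorState ε m) y
          + (deriv θ y * deriv (oscillatorState ε m) y
            + θ y * deriv (deriv (oscillatorState ε m)) y) : ℝ) : ℂ) y := fun y =>
      (((dr hθ' y).mul (dr (hosc ε) y)).add ((dr hθ y).mul (dr hosc' y))).ofReal_comp
    simp only [hη₀]
    rw [sum_fderiv_fderiv_product p d hd da db da' db' q]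
    obtain ⟨g1, g2, g3⟩ := hb ε hε (frameCoord p d q).2
    exact norm_remainder_le hε hε1 (oscillatorState_eigen hε m _) (kpos q) hB hK (hc ε hε hε1)
      (b0 _) (b1 _) (b2 _) g1 g2 g3 (h ε hε hε1 q)

/-! ### The distance from the graph near a line -/

lemma isClosed_closedEdge (p d : Plane) (hd : ‖d‖ = 1) (l : ℝ≥0∞) : IsClosed (closedEdge p d l) := by
  have hi : Isometry fun x : ℝ => p + x • d := Isometry.of_dist_eq fun x y => by
    rw [dist_add_left, dist_eq_norm, ← sub_smul, norm_smul, hd, mul_one, dist_eq_norm]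
  refine hi.isClosedEmbedding.isClosedMap _ ?_
  exact (isClosed_le continuous_const continuous_id).inter
    (isClosed_le ENNReal.continuous_ofReal continuous_const)

lemma norm_rot (d : Plane) (hd : ‖d‖ = 1) : ‖rot d‖ = 1 := (orthonormal_frame d hd).1 1

lemma inner_rot_self (d : Plane) (hd : ‖d‖ = 1) : inner ℝ (rot d) d = 0 :=
  (orthonormal_frame d hd).2 (show (1 : Fin 2) ≠ 0 by decide)

namespace StraightGraph

variable {V E : Type*} (Γ : StraightGraph V E)

/-- The open edge `e` as a subset of the plane. -/
def edgeInterior (e : E) : Set Plane := openEdge (Γ.pos (Γ.source e)) (Γ.dir e) (Γ.length e)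

/-- The edge `e` with its end points as a subset of the plane. -/
def edgeClosure (e : E) : Set Plane := closedEdge (Γ.pos (Γ.source e)) (Γ.dir e) (Γ.length e)

lemma edgeClosure_subset (e : E) : Γ.edgeClosure e ⊆ Γ.edgeInterior e ∪ range Γ.pos := by
  rintro _ ⟨x, ⟨h0, hl⟩, rfl⟩
  rcases h0.eq_or_lt with rfl | h0
  · exact Or.inr ⟨Γ.source e, by simp⟩
  rcases hl.eq_or_lt with h | h
  · obtain ⟨v, hv⟩ := Γ.exists_target e (by rw [← h]; exact ENNReal.ofReal_ne_top)
    refine Or.inr ⟨v, ?_⟩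
    rw [hv, ← h, ENNReal.toReal_ofReal h0.le]
  · exact Or.inl ⟨x, ⟨h0, h⟩, rfl⟩

lemma edgeInterior_subset_carrier (e : E) : Γ.edgeInterior e ⊆ Γ.carrier := by
  rintro _ ⟨x, ⟨h0, hl⟩, rfl⟩
  exact mem_iUnion.2 ⟨e, x, ⟨h0.le, hl.le⟩, rfl⟩

lemma isClosed_carrier [Finite E] : IsClosed Γ.carrier :=
  isClosed_iUnion_of_finite fun e => isClosed_closedEdge _ _ (Γ.norm_dir e) _

/-- The other edges form a finite union of closed sets, which misses `q`: a point interior to one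
edge is neither a vertex nor interior to another. -/
lemma exists_le_dist_of_mem_edgeInterior [Finite E] {q : Plane} {e : E}
    (hq : q ∈ Γ.edgeInterior e) :
    ∃ δ > 0, ∀ e', e' ≠ e → ∀ z ∈ Γ.edgeClosure e', δ ≤ dist q z := by
  have hc : IsClosed (⋃ e' : {e' // e' ≠ e}, Γ.edgeClosure e') :=
    isClosed_iUnion_of_finite fun e' => isClosed_closedEdge _ _ (Γ.norm_dir _) _
  have hn : q ∉ ⋃ e' : {e' // e' ≠ e}, Γ.edgeClosure e' := by
    rw [mem_iUnion]
    rintro ⟨⟨e', he'⟩, h⟩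
    rcases Γ.edgeClosure_subset e' h with h | ⟨v, rfl⟩
    · exact disjoint_left.1 (Γ.disjoint_openEdge e' e he') h hq
    · exact Γ.pos_notMem_openEdge v e hq
  obtain ⟨δ, hδ, hb⟩ := Metric.isOpen_iff.1 hc.isOpen_compl q hn
  refine ⟨δ, hδ, fun e' he' z hz => not_lt.1 fun hlt => ?_⟩
  exact hb (by rwa [Metric.mem_ball, dist_comm]) (mem_iUnion.2 ⟨⟨e', he'⟩, hz⟩)

/-- The point with parameter `x` of the line through `p` along `d` lies in the interior of an edge
contained in that line. -/
def MemCollinearEdge (p d : Plane) (x : ℝ) : Prop :=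
  ∃ e, p + x • d ∈ Γ.edgeInterior e ∧ inner ℝ (rot d) (Γ.dir e) = 0

/-- Close to `x₀` the foot of the perpendicular to the line belongs to the collinear edge, which
gives `≤`. For `≥`, that edge stays on the line and the remaining edges are too far away. The edge
may differ from the one defining the frame: the full line has to be covered, not only the edge
itself. -/
lemma exists_infDist_eq_abs [Finite E] {p d : Plane} (hd : ‖d‖ = 1) {x₀ : ℝ}
    (h : Γ.MemCollinearEdge p d x₀) :
    ∃ δ > 0, ∀ x y, |x - x₀| < δ → |y| < δ →
      Metric.infDist (framePoint p d (x, y)) Γ.carrier = |y| := by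
  obtain ⟨e, he, hdir⟩ := h
  obtain ⟨δ₀, hδ₀, hfar⟩ := Γ.exists_le_dist_of_mem_edgeInterior he
  obtain ⟨s₀, hs₀, hps⟩ := he
  -- Here `τ = ±1`, as the edge may be oriented against `d`.
  obtain ⟨τ, hτ⟩ : ∃ τ : ℝ, d = τ • Γ.dir e := by
    have h1 := framePoint_frameCoord 0 d hd (Γ.dir e)
    simp only [framePoint, frameCoord, sub_zero, hdir, zero_smul, add_zero, zero_add] at h1
    have h2 : |(inner ℝ d (Γ.dir e) : ℝ)| = 1 := by
      have := congrArg norm h1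
      rwa [norm_smul, hd, mul_one, Γ.norm_dir, Real.norm_eq_abs] at this
    refine ⟨inner ℝ d (Γ.dir e), ?_⟩
    conv_rhs => rw [← h1]
    rw [inner_smul_right, real_inner_self_eq_norm_sq, hd, smul_smul]
    have h3 : (inner ℝ d (Γ.dir e) : ℝ) * inner ℝ d (Γ.dir e) = 1 := by
      rw [← sq, ← sq_abs, h2, one_pow]
    simp [h3]
  have hopen : ∀ᶠ x in 𝓝 x₀, p + x • d ∈ Γ.edgeInterior e := by
    have hc : Tendsto (fun x : ℝ => s₀ + (x - x₀) * τ) (𝓝 x₀) (𝓝 s₀) := by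
      have : Continuous fun x : ℝ => s₀ + (x - x₀) * τ := by fun_prop
      simpa using this.tendsto x₀
    filter_upwards [hc.eventually ((edgeInterval (Γ.length e)).isOpen.mem_nhds hs₀)] with x hx
    refine ⟨_, hx, ?_⟩
    have e1 : p + x • d = (p + x₀ • d) + (x - x₀) • d := by rw [sub_smul]; abel
    rw [e1, ← hps]
    conv_rhs => rw [hτ]
    simp only [add_smul, smul_smul, add_assoc]
  obtain ⟨δ₁, hδ₁, hnear⟩ := Metric.eventually_nhds_iff.1 hopen
  -- The displacement from `p + x₀ • d` is less than `2δ₀/3`, so the other edges remain farther than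
  -- `δ₀/3 > |y|`.
  refine ⟨min δ₁ (δ₀ / 3), by positivity, fun x y hx hy => ?_⟩
  have hx1 := hx.trans_le (min_le_left _ _)
  have hx2 := hx.trans_le (min_le_right _ _)
  have hy2 := hy.trans_le (min_le_right _ _)
  have hmem := Γ.edgeInterior_subset_carrier e (hnear (y := x) (by rwa [Real.dist_eq]))
  have hrot := norm_rot d hd
  refine le_antisymm ?_ ?_
  · refine (Metric.infDist_le_dist_of_mem hmem).trans_eq ?_
    rw [dist_eq_norm, framePoint, add_sub_cancel_left, norm_smul, hrot, mul_one, Real.norm_eq_abs]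
  · rw [Metric.le_infDist ⟨_, hmem⟩]
    intro z hz
    obtain ⟨e', hz⟩ := mem_iUnion.1 hz
    by_cases hee : e' = e
    · subst hee
      obtain ⟨s, -, rfl⟩ := hz
      have i0 : inner ℝ (rot d) (Γ.pos (Γ.source e') + s₀ • Γ.dir e') = inner ℝ (rot d) (p + x₀ • d) :=
        congrArg _ hps
      have i1 := inner_rot_self d hd
      simp only [inner_add_right, inner_smul_right, hdir, i1, mul_zero, add_zero] at i0
      have i2 : inner ℝ (rot d) (framePoint p d (x, y)
          - (Γ.pos (Γ.source e') + s • Γ.dir e')) = y := by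
        rw [inner_sub_right, framePoint]
        simp only [inner_add_right, inner_smul_right, hdir, i1, mul_zero, add_zero, i0,
          real_inner_self_eq_norm_sq, hrot]
        ring
      calc |y| ≤ ‖rot d‖ * ‖framePoint p d (x, y) - (Γ.pos (Γ.source e') + s • Γ.dir e')‖ := by
            conv_lhs => rw [← i2]
            exact abs_real_inner_le_norm _ _
        _ = _ := by rw [hrot, one_mul, dist_eq_norm]
    · have h1 := hfar e' hee z hz
      have h2 : dist (p + x₀ • d) (framePoint p d (x, y)) ≤ |x - x₀| + |y| := by
        rw [dist_comm, dist_eq_norm]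
        have : framePoint p d (x, y) - (p + x₀ • d) = (x - x₀) • d + y • rot d := by
          rw [framePoint, sub_smul]; abel
        rw [this]
        refine (norm_add_le _ _).trans_eq ?_
        rw [norm_smul, norm_smul, hrot, hd, mul_one, mul_one, Real.norm_eq_abs, Real.norm_eq_abs]
      have h3 := dist_triangle (p + x₀ • d) (framePoint p d (x, y)) z
      linarith

/-- An edge transversal to the line meets it at most once. A point of a parallel edge on the line is
either interior to that edge, hence not exceptional, or one of the finitely many vertices. -/
lemma finite_setOf_exceptional [Finite V] [Finite E] {p d : Plane} (hd : ‖d‖ = 1) :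
    {x : ℝ | p + x • d ∈ Γ.carrier ∧ ¬ Γ.MemCollinearEdge p d x}.Finite := by
  have hinj : Function.Injective fun x : ℝ => p + x • d := fun x y hxy => by
    have hd0 : d ≠ 0 := fun h0 => by simp [h0] at hd
    exact smul_left_injective ℝ hd0 (add_left_cancel hxy)
  have hv : {x : ℝ | p + x • d ∈ range Γ.pos}.Finite :=
    (finite_range Γ.pos).preimage hinj.injOn
  have ht : ∀ e, inner ℝ (rot d) (Γ.dir e) ≠ 0 → {x : ℝ | p + x • d ∈ Γ.edgeClosure e}.Finite := by
    refine fun e he => Set.Subsingleton.finite ?_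
    rintro x ⟨s, -, hs⟩ x' ⟨s', -, hs'⟩
    have i1 := inner_rot_self d hd
    have e1 := congrArg (inner ℝ (rot d)) hs
    have e2 := congrArg (inner ℝ (rot d)) hs'
    simp only [inner_add_right, inner_smul_right, i1, mul_zero, add_zero] at e1 e2
    have hss : s = s' := mul_right_cancel₀ he (by linarith)
    subst hss
    exact hinj (hs.symm.trans hs')
  refine (hv.union (finite_iUnion fun e : {e // inner ℝ (rot d) (Γ.dir e) ≠ 0} =>
    ht e e.2)).subset ?_
  rintro x ⟨hx, hn⟩
  obtain ⟨e, he⟩ := mem_iUnion.1 hx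
  by_cases hr : inner ℝ (rot d) (Γ.dir e) = 0
  · rcases Γ.edgeClosure_subset e he with h | h
    · exact absurd ⟨e, h, hr⟩ hn
    · exact Or.inl h
  · exact Or.inr (mem_iUnion.2 ⟨⟨e, hr⟩, he⟩)

end StraightGraph

/-! ### Components along the transverse modes -/

/-- The last bound says that removing the cutoff costs `O(|y|)`, the error allowed in
`exists_approx_preimage`. It holds because `θ = 1` for `|y| ≤ r/2`, while the right side is at least
`1` beyond. -/
lemma exists_cutoff {r : ℝ} (hr : 0 < r) : ∃ θ : ℝ → ℝ, ContDiff ℝ ∞ θ ∧ HasCompactSupport θ ∧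
    (∀ y, 0 ≤ θ y) ∧ (∀ y, θ y ≤ 1) ∧ (∀ y, r ≤ |y| → θ y = 0) ∧
    ∀ y, |θ y - 1| ≤ 2 / r * |y| := by
  let b : ContDiffBump (0 : ℝ) := ⟨r / 2, r, by positivity, by linarith⟩
  refine ⟨b, b.contDiff, b.hasCompactSupport, fun _ => b.nonneg, fun _ => b.le_one,
    fun y hy => b.zero_of_le_dist (by simpa using hy), fun y => ?_⟩
  rcases le_or_gt |y| (r / 2) with hy | hy
  · rw [b.one_of_mem_closedBall (by simpa using hy), sub_self, abs_zero]
    positivity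
  · have h1 : 1 ≤ 2 / r * |y| := by
      rw [div_mul_eq_mul_div, one_le_div hr]
      linarith
    refine le_trans ?_ h1
    rw [abs_le]
    constructor <;> linarith [b.nonneg (x := y), b.le_one (x := y)]

namespace StraightGraph

variable {V E : Type*} (Γ : StraightGraph V E)

lemma transverseComponent_eq (ε : ℝ) (m : ℕ) (j : E) (ψ : L2Plane) :
    Γ.transverseComponent ε m j ψ = (tensorRight (Γ.pos (Γ.source j)) (Γ.dir j) (Γ.norm_dir j)
      (memLp_oscillatorState ε m)).adjoint ψ :=
  toLp_transverse _ _ _ _ ψ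

lemma norm_evolution {ε : ℝ} (hε : 0 < ε) (n : ℕ) (t : ℝ) (ψ₀ : L2Plane) :
    ‖Γ.evolution ε n t ψ₀‖ = ‖ψ₀‖ := by
  rw [evolution, norm_smul, (isUnitaryGroup_hamiltonian Γ.carrier hε).norm_map,
    show I * t * ((n + 1 / 2) / ε) = ((t * ((n + 1 / 2) / ε) : ℝ) : ℂ) * I by push_cast; ring,
    norm_exp_ofReal_mul_I, one_mul]

lemma continuous_evolution {ε : ℝ} (hε : 0 < ε) (n : ℕ) (ψ₀ : L2Plane) :
    Continuous fun t => Γ.evolution ε n t ψ₀ := by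
  have := (isUnitaryGroup_hamiltonian Γ.carrier hε).continuous ψ₀
  unfold evolution
  fun_prop

lemma exists_norm_initialState_le (n : ℕ) (j : E) (f : 𝓓(edgeInterval (Γ.length j), ℂ)) :
    ∃ M, ∀ ε > 0, ‖Γ.initialState ε n j f‖ ≤ M := by
  obtain ⟨C, hC⟩ := exists_norm_oscillatorState_le n
  refine ⟨‖(f.continuous.memLp_of_hasCompactSupport (p := 2) (μ := volume)
    f.hasCompactSupport).toLp‖ * C, fun ε hε => ?_⟩
  refine (norm_productState (Γ.pos (Γ.source j)) (Γ.dir j) (Γ.norm_dir j)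
    (f.continuous.memLp_of_hasCompactSupport f.hasCompactSupport)
    (memLp_oscillatorState ε n)).trans_le ?_
  gcongr
  exact hC ε hε

/-- The bridge from approximate preimages to vanishing means: the time-integral estimate is applied
with `κ = v(x) Φ_m^ε(y)` and `λ = E_n/ε`, whose phase is the one in `evolution`. -/
lemma tendsto_mean_transverseComponent (n m : ℕ) (j : E) {ψ₀ : ℝ → L2Plane} {M : ℝ}
    (hM : ∀ ε > 0, ‖ψ₀ ε‖ ≤ M) {v : L2Line} {φ η : ℝ → L2Plane}
    (hη : ∀ ε > 0, IsHamiltonian Γ.carrier ε (φ ε) (η ε))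
    (h1 : Tendsto (fun ε => ‖φ ε‖) (𝓝[>] 0) (𝓝 0))
    (h2 : Tendsto (fun ε => ‖tensorRight (Γ.pos (Γ.source j)) (Γ.dir j) (Γ.norm_dir j)
      (memLp_oscillatorState ε m) v - (η ε - (((n + 1 / 2) / ε : ℝ) : ℂ) • φ ε)‖)
      (𝓝[>] 0) (𝓝 0)) (a b : ℝ) :
    Tendsto (fun ε => ∫ t in Ioo a b,
      inner ℂ v (Γ.transverseComponent ε m j (Γ.evolution ε n t (ψ₀ ε)))) (𝓝[>] 0) (𝓝 0) := by
  have h3 := (((h1.const_mul 2).add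
    (h2.const_mul ((volume.restrict (Ioo a b)).real univ))).mul_const M)
  simp only [mul_zero, add_zero, zero_mul] at h3
  refine squeeze_zero_norm' ?_ h3
  filter_upwards [self_mem_nhdsWithin] with ε hε
  simp only [transverseComponent_eq, ContinuousLinearMap.adjoint_inner_right]
  have key := (isUnitaryGroup_hamiltonian Γ.carrier hε).norm_integral_inner_le (hη ε hε) (ψ₀ ε)
    (tensorRight (Γ.pos (Γ.source j)) (Γ.dir j) (Γ.norm_dir j) (memLp_oscillatorState ε m) v)
    ((n + 1 / 2) / ε) a b
  refine le_trans (le_of_eq ?_) (key.trans ?_)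
  · simp only [evolution]
    push_cast
    rfl
  · gcongr
    exact hM ε hε

/-! ### The two families of approximate preimages -/

/-- Scaling by `2ε²` turns the multiplier into `2ε(m - n) + d_Γ² - y²`. The distance is 1-Lipschitz,
so this is `W(x)² + O(|y| + ε)` on the support of the cutoff and for `x` in a compact set. The
potential alone does the work, so `m` and `n` may coincide. -/
lemma exists_approx_preimage_infDist_sq_mul [Nonempty E] {p d : Plane} (hd : ‖d‖ = 1) (m n : ℕ)
    {u : ℝ → ℝ} (hu : ContDiff ℝ ∞ u) (huc : HasCompactSupport u)
    (hv : MemLp (fun x => ((Metric.infDist (p + x • d) Γ.carrier ^ 2 * u x : ℝ) : ℂ)) 2 volume) :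
    ∃ φ η : ℝ → L2Plane, (∀ ε > 0, IsHamiltonian Γ.carrier ε (φ ε) (η ε)) ∧
      Tendsto (fun ε => ‖φ ε‖) (𝓝[>] 0) (𝓝 0) ∧
      Tendsto (fun ε => ‖tensorRight p d hd (memLp_oscillatorState ε m) hv.toLp
        - (η ε - (((n + 1 / 2) / ε : ℝ) : ℂ) • φ ε)‖) (𝓝[>] 0) (𝓝 0) := by
  -- Radius `2` makes the constant `2/r` equal to `1`; what matters later is that `|y| θ(y)` is
  -- bounded, so that quadratic terms in `y` become linear.
  obtain ⟨θ, hθ, hθc, h0, h1, hz, hl⟩ := exists_cutoff two_pos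
  set W : ℝ → ℝ := fun x => Metric.infDist (p + x • d) Γ.carrier with hW
  have hWc : Continuous W := (Metric.continuous_infDist_pt _).comp (by fun_prop)
  -- The error factor collects the four bounds `a1` to `a4` below: the energy gap, `y²`, `d_Γ² - W²`
  -- and the cutoff.
  have hk : MemLp (fun x => ((|u x| * (2 * |(m : ℝ) - n| + 4 + 2 * W x + W x ^ 2) : ℝ) : ℂ)) 2
      volume := by
    refine Continuous.memLp_of_hasCompactSupport (by have := hu.continuous; fun_prop) ?_
    exact (huc.abs.mul_right (f' := fun x => 2 * |(m : ℝ) - n| + 4 + 2 * W x + W x ^ 2)).comp_left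
      ofReal_zero
  refine exists_approx_preimage Γ.carrier p d hd m n hu huc hθ hθc hv hk (c := fun ε => 2 * ε ^ 2)
    (K := 2) (fun ε hε hε1 => ?_) fun ε hε hε1 q => ?_
  · rw [abs_of_nonneg (by positivity)]
    nlinarith
  have hq := framePoint_frameCoord p d hd q
  generalize frameCoord p d q = z at *
  obtain ⟨x, y⟩ := z
  simp only
  have hDW : |Metric.infDist q Γ.carrier - W x| ≤ |y| := by
    have h := (Metric.lipschitz_infDist_pt Γ.carrier).dist_le_mul q (p + x • d)
    rw [Real.dist_eq] at h
    refine h.trans_eq ?_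
    rw [dist_eq_norm, ← hq, framePoint, add_sub_cancel_left, norm_smul, norm_rot d hd]
    simp
  have hW0 : 0 ≤ W x := Metric.infDist_nonneg
  have hD0 : 0 ≤ Metric.infDist q Γ.carrier := Metric.infDist_nonneg
  change |_ - W x ^ 2 * u x| ≤ |u x| * (2 * |(m : ℝ) - n| + 4 + 2 * W x + W x ^ 2) * (|y| + ε)
  generalize Metric.infDist q Γ.carrier = D at *
  generalize W x = w at *
  have e : 2 * ε ^ 2 * (((m : ℝ) - n) / ε + (D ^ 2 - y ^ 2) / (2 * ε ^ 2)) * θ y * u x - w ^ 2 * u x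
      = u x * (2 * ε * ((m : ℝ) - n) * θ y - y ^ 2 * θ y + (D ^ 2 - w ^ 2) * θ y
        + w ^ 2 * (θ y - 1)) := by
    field_simp
    ring
  rw [e, abs_mul, mul_assoc |u x|]
  refine mul_le_mul_of_nonneg_left ?_ (abs_nonneg _)
  have hθa : |θ y| = θ y := abs_of_nonneg (h0 y)
  have hy : |y| * θ y ≤ 2 := by
    rcases le_or_gt 2 |y| with hy | hy
    · rw [hz y hy]; simp
    · calc |y| * θ y ≤ 2 * 1 := mul_le_mul hy.le (h1 y) (h0 y) two_pos.le
        _ = 2 := mul_one _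
  have a1 : |2 * ε * ((m : ℝ) - n) * θ y| ≤ 2 * |(m : ℝ) - n| * ε := by
    rw [abs_mul, abs_mul, hθa, abs_of_pos (by positivity : 0 < 2 * ε)]
    calc 2 * ε * |(m : ℝ) - n| * θ y ≤ 2 * ε * |(m : ℝ) - n| * 1 := by gcongr; exact h1 y
      _ = _ := by ring
  have a2 : |y ^ 2 * θ y| ≤ 2 * |y| := by
    rw [abs_mul, hθa, abs_pow]
    nlinarith [abs_nonneg y]
  have a3 : |(D ^ 2 - w ^ 2) * θ y| ≤ (2 * w + 2) * |y| := by
    have hDw : D + w ≤ 2 * w + |y| := by linarith [(abs_le.1 hDW).2]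
    rw [abs_mul, hθa, sq_sub_sq, abs_mul, abs_of_nonneg (by positivity : 0 ≤ D + w)]
    calc (D + w) * |D - w| * θ y ≤ (2 * w + |y|) * |y| * θ y := by
          gcongr
          exact h0 y
      _ = 2 * w * |y| * θ y + |y| * (|y| * θ y) := by ring
      _ ≤ 2 * w * |y| * 1 + |y| * 2 := by gcongr; exact h1 y
      _ = _ := by ring
  have a4 : |w ^ 2 * (θ y - 1)| ≤ w ^ 2 * |y| := by
    rw [abs_mul, abs_of_nonneg (sq_nonneg w)]
    have h := hl y
    rw [div_self two_ne_zero, one_mul] at h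
    exact mul_le_mul_of_nonneg_left h (sq_nonneg w)
  have t1 := abs_add_le (2 * ε * ((m : ℝ) - n) * θ y - y ^ 2 * θ y + (D ^ 2 - w ^ 2) * θ y)
    (w ^ 2 * (θ y - 1))
  have t2 := abs_add_le (2 * ε * ((m : ℝ) - n) * θ y - y ^ 2 * θ y) ((D ^ 2 - w ^ 2) * θ y)
  have t3 := norm_sub_le (2 * ε * ((m : ℝ) - n) * θ y) (y ^ 2 * θ y)
  simp only [Real.norm_eq_abs] at t3
  have q1 : 0 ≤ |(m : ℝ) - n| * |y| := by positivity
  have q2 : 0 ≤ (4 + 2 * w + w ^ 2) * ε := by positivity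
  nlinarith

/-- Where `u(x) θ(y) ≠ 0` the potential is exactly that of the oscillator, so only the gap `(m -
n)/ε` is left in the multiplier, and `c = ε/(m - n)` inverts it. The only defect is `(θ - 1) u`. -/
lemma exists_approx_preimage_of_infDist_eq_abs {p d : Plane} (hd : ‖d‖ = 1) {m n : ℕ} (hmn : m ≠ n)
    {x₀ δ : ℝ} (hδ : 0 < δ) (hdist : ∀ x y, |x - x₀| < δ → |y| < δ →
      Metric.infDist (framePoint p d (x, y)) Γ.carrier = |y|)
    {u : ℝ → ℝ} (hu : ContDiff ℝ ∞ u) (huc : HasCompactSupport u)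
    (hus : tsupport u ⊆ Metric.ball x₀ δ) (hv : MemLp (fun x => (u x : ℂ)) 2 volume) :
    ∃ φ η : ℝ → L2Plane, (∀ ε > 0, IsHamiltonian Γ.carrier ε (φ ε) (η ε)) ∧
      Tendsto (fun ε => ‖φ ε‖) (𝓝[>] 0) (𝓝 0) ∧
      Tendsto (fun ε => ‖tensorRight p d hd (memLp_oscillatorState ε m) hv.toLp
        - (η ε - (((n + 1 / 2) / ε : ℝ) : ℂ) • φ ε)‖) (𝓝[>] 0) (𝓝 0) := by
  obtain ⟨θ, hθ, hθc, h0, h1, hz, hl⟩ := exists_cutoff hδ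
  have hmn' : (m : ℝ) - n ≠ 0 := sub_ne_zero.2 (by exact_mod_cast hmn)
  have hk : MemLp (fun x => ((2 / δ * |u x| : ℝ) : ℂ)) 2 volume := by
    refine Continuous.memLp_of_hasCompactSupport (by have := hu.continuous; fun_prop) ?_
    exact (huc.abs.mul_left (f := fun _ => 2 / δ)).comp_left ofReal_zero
  refine exists_approx_preimage Γ.carrier p d hd m n hu huc hθ hθc hv hk
    (c := fun ε => ε / ((m : ℝ) - n)) (K := |(m : ℝ) - n|⁻¹) (fun ε hε hε1 => ?_)
    fun ε hε hε1 q => ?_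
  · rw [abs_div, abs_of_pos hε, div_eq_mul_inv, mul_comm]
  have hq := framePoint_frameCoord p d hd q
  generalize frameCoord p d q = z at *
  obtain ⟨x, y⟩ := z
  simp only
  -- The term singular like `1/ε²` vanishes identically: the cutoff has radius `δ` and `u` is
  -- supported in the ball where `d_Γ = |y|`.
  have hcancel : (Metric.infDist q Γ.carrier ^ 2 - y ^ 2) * (θ y * u x) = 0 := by
    by_cases hy : δ ≤ |y|
    · rw [hz y hy]; ring
    by_cases hx : u x = 0
    · rw [hx]; ring
    have hx' := hus (subset_tsupport u hx)
    rw [Metric.mem_ball, Real.dist_eq] at hx'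
    rw [← hq, hdist x y hx' (not_le.1 hy), sq_abs]
    ring
  have e : ε / ((m : ℝ) - n) * (((m : ℝ) - n) / ε
      + (Metric.infDist q Γ.carrier ^ 2 - y ^ 2) / (2 * ε ^ 2)) * θ y * u x - u x
      = (θ y - 1) * u x := by
    have : ε / ((m : ℝ) - n) * (((m : ℝ) - n) / ε
      + (Metric.infDist q Γ.carrier ^ 2 - y ^ 2) / (2 * ε ^ 2)) * θ y * u x - u x
      = (θ y - 1) * u x + ε / ((m : ℝ) - n) / (2 * ε ^ 2)
        * ((Metric.infDist q Γ.carrier ^ 2 - y ^ 2) * (θ y * u x)) := by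
      field_simp
      ring
    rw [this, hcancel, mul_zero, add_zero]
  rw [e, abs_mul]
  calc |θ y - 1| * |u x| ≤ 2 / δ * |y| * |u x| := by gcongr; exact hl y
    _ = 2 / δ * |u x| * |y| := by ring
    _ ≤ 2 / δ * |u x| * (|y| + ε) := by gcongr; linarith

end StraightGraph

/-! ### Density of the admissible test vectors, and the conclusion -/

lemma inner_toLp_ofReal {v : ℝ → ℝ} (hv : MemLp (fun x => (v x : ℂ)) 2 volume) (g : L2Line) :
    inner ℂ hv.toLp g = ∫ x, v x • g x := by
  rw [L2.inner_def]
  refine integral_congr_ae ?_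
  filter_upwards [hv.coeFn_toLp] with x hx
  rw [hx, RCLike.inner_apply, real_smul, mul_comm]
  simp

/-- The line splits into three parts. Off `Γ` the weight `W²` is positive, so the family `hA` kills
`g`; near points interior to collinear edges `hB` does; the rest is finite, hence null. -/
lemma StraightGraph.eq_zero_of_orthogonal {V E : Type*} [Finite V] [Finite E] [Nonempty E]
    (Γ : StraightGraph V E)
    {p d : Plane} (hd : ‖d‖ = 1) {S : Set L2Line}
    (hA : ∀ u : ℝ → ℝ, ContDiff ℝ ∞ u → HasCompactSupport u →
      ∀ hv : MemLp (fun x => ((Metric.infDist (p + x • d) Γ.carrier ^ 2 * u x : ℝ) : ℂ)) 2 volume,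
        hv.toLp ∈ S)
    (hB : ∀ x₀ δ : ℝ, 0 < δ → (∀ x y, |x - x₀| < δ → |y| < δ →
      Metric.infDist (framePoint p d (x, y)) Γ.carrier = |y|) → ∀ u : ℝ → ℝ, ContDiff ℝ ∞ u →
      HasCompactSupport u → tsupport u ⊆ Metric.ball x₀ δ →
      ∀ hv : MemLp (fun x => (u x : ℂ)) 2 volume, hv.toLp ∈ S)
    {g : L2Line} (hg : ∀ v ∈ S, inner ℂ v g = 0) : g = 0 := by
  have hgl : LocallyIntegrable g volume := (Lp.memLp g).locallyIntegrable one_le_two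
  set W : ℝ → ℝ := fun x => Metric.infDist (p + x • d) Γ.carrier with hW
  have hWc : Continuous W := (Metric.continuous_infDist_pt _).comp (by fun_prop)
  have hne : Γ.carrier.Nonempty := by
    obtain ⟨e⟩ := ‹Nonempty E›
    exact ⟨_, mem_iUnion.2 ⟨e, 0, ⟨le_rfl, by simp⟩, rfl⟩⟩
  have h1 : ∀ᵐ x, W x ^ 2 • g x = 0 := by
    refine ae_eq_zero_of_integral_contDiff_smul_eq_zero ?_ fun u hu huc => ?_
    · rw [← locallyIntegrableOn_univ] at hgl ⊢
      exact hgl.continuousOn_smul isOpen_univ.isLocallyClosed (hWc.pow 2).continuousOn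
    have hv : MemLp (fun x => ((W x ^ 2 * u x : ℝ) : ℂ)) 2 volume := by
      refine Continuous.memLp_of_hasCompactSupport (by have := hu.continuous; fun_prop) ?_
      exact (huc.mul_left (f := fun x => W x ^ 2)).comp_left ofReal_zero
    have := hg _ (hA u hu huc hv)
    rw [inner_toLp_ofReal] at this
    rw [← this]
    refine integral_congr_ae (ae_of_all _ fun x => ?_)
    change u x • W x ^ 2 • g x = (W x ^ 2 * u x) • g x
    rw [smul_smul, mul_comm]
  -- The radius `δ` depends on the point, so `g` is shown to vanish a.e. locally, and second
  -- countability of the line makes the exceptional set null.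
  have h2 : volume {x | Γ.MemCollinearEdge p d x ∧ g x ≠ 0} = 0 := by
    refine measure_null_of_locally_null _ fun x₀ hx₀ => ?_
    obtain ⟨δ, hδ, hdist⟩ := Γ.exists_infDist_eq_abs hd hx₀.1
    have h3 : ∀ᵐ x, x ∈ Metric.ball x₀ δ → g x = 0 := by
      refine Metric.isOpen_ball.ae_eq_zero_of_integral_contDiff_smul_eq_zero
        (hgl.locallyIntegrableOn _) fun u hu huc hus => ?_
      have hv : MemLp (fun x => (u x : ℂ)) 2 volume :=
        (hu.continuous.memLp_of_hasCompactSupport huc).ofReal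
      rw [← inner_toLp_ofReal hv]
      exact hg _ (hB x₀ δ hδ hdist u hu huc hus hv)
    refine ⟨{x | x ∈ Metric.ball x₀ δ ∧ g x ≠ 0}, ?_, ?_⟩
    · rw [mem_nhdsWithin]
      exact ⟨_, Metric.isOpen_ball, Metric.mem_ball_self hδ, fun x hx => ⟨hx.1, hx.2.2⟩⟩
    · rw [ae_iff] at h3
      simpa only [Classical.not_imp] using h3
  have h4 : ∀ᵐ x, ¬ (p + x • d ∈ Γ.carrier ∧ ¬ Γ.MemCollinearEdge p d x) :=
    (Γ.finite_setOf_exceptional hd).countable.ae_notMem volume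
  refine Lp.ext ?_
  have h5 : ∀ᵐ x, ¬ (Γ.MemCollinearEdge p d x ∧ g x ≠ 0) := by
    rw [ae_iff]; simpa only [not_not] using h2
  filter_upwards [h1, h4, h5, Lp.coeFn_zero ℂ 2 (volume : Measure ℝ)] with x e1 e2 e3 e4
  rw [e4]
  by_contra hx
  have hcol : ¬ Γ.MemCollinearEdge p d x := fun h => e3 ⟨h, hx⟩
  have hnot : p + x • d ∉ Γ.carrier := fun h => e2 ⟨h, hcol⟩
  -- Closedness of `Γ`, which comes from finiteness of the edge set, makes `W` positive off `Γ`.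
  have hpos := (Γ.isClosed_carrier.notMem_iff_infDist_pos hne).1 hnot
  rcases smul_eq_zero.1 e1 with h | h
  · exact (pow_ne_zero 2 hpos.ne') h
  · exact hx h

theorem mainTheorem3 {V E : Type*} [Finite V] [Finite E] (Γ : StraightGraph V E)
    (n : ℕ) (j₀ : E) (f : 𝓓(edgeInterval (Γ.length j₀), ℂ)) (T : ℝ) (hT : 0 < T)
    (m : ℕ) (hmn : m ≠ n) (j : E) :
    WeakStarTendsto T
      (fun ε t => Γ.transverseComponent ε m j (Γ.evolution ε n t (Γ.initialState ε n j₀ f)))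
      0 := by
  have : Nonempty E := ⟨j⟩
  obtain ⟨M, hM⟩ := Γ.exists_norm_initialState_le n j₀ f
  obtain ⟨C, hC⟩ := exists_norm_oscillatorState_le m
  have hC0 : 0 ≤ C := (norm_nonneg _).trans (hC 1 one_pos)
  -- Unitarity and the uniform bounds on the modes give a bound independent of `ε` and `t`; it
  -- yields membership in `L^∞` and feeds the weak-star criterion.
  have hb : ∀ ε > 0, ∀ t, ‖Γ.transverseComponent ε m j
      (Γ.evolution ε n t (Γ.initialState ε n j₀ f))‖ ≤ C * M := fun ε hε t => by
    rw [Γ.transverseComponent_eq]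
    refine (ContinuousLinearMap.le_opNorm _ _).trans ?_
    rw [Γ.norm_evolution hε, LinearIsometryEquiv.norm_map]
    exact mul_le_mul ((norm_tensorRight_le _ _ _ _).trans (hC ε hε)) (hM ε hε) (norm_nonneg _) hC0
  have hc : ∀ ε > 0, Continuous fun t => Γ.transverseComponent ε m j
      (Γ.evolution ε n t (Γ.initialState ε n j₀ f)) := fun ε hε => by
    simp only [Γ.transverseComponent_eq]
    exact (ContinuousLinearMap.continuous _).comp (Γ.continuous_evolution hε n _)
  refine ⟨fun ε hε => memLp_top_of_bound (hc ε hε).aestronglyMeasurable _ (ae_of_all _ (hb ε hε)),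
    MemLp.zero, fun g hg => ?_⟩
  simp only [Pi.zero_apply, inner_zero_right, integral_zero]
  refine tendsto_integral_inner_of_mean (fun ε t => Γ.transverseComponent ε m j
    (Γ.evolution ε n t (Γ.initialState ε n j₀ f))) hb hc (fun v hv => ?_) T g hg
  refine Γ.eq_zero_of_orthogonal (Γ.norm_dir j) (p := Γ.pos (Γ.source j)) (S := meanNullSubmodule
    (fun ε t => Γ.transverseComponent ε m j (Γ.evolution ε n t (Γ.initialState ε n j₀ f))) hb hc)
    (fun u hu huc hv => ?_) (fun x₀ δ hδ hdist u hu huc hus hv => ?_) hv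
  · obtain ⟨φ, η, h1, h2, h3⟩ :=
      Γ.exists_approx_preimage_infDist_sq_mul (Γ.norm_dir j) m n hu huc hv
    exact Γ.tendsto_mean_transverseComponent n m j hM h1 h2 h3
  · obtain ⟨φ, η, h1, h2, h3⟩ :=
      Γ.exists_approx_preimage_of_infDist_eq_abs (Γ.norm_dir j) hmn hδ hdist hu huc hus hv
    exact Γ.tendsto_mean_transverseComponent n m j hM h1 h2 h3
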